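/- **Objects, histories, linearizability.** A sequential object is a tuple $(Q,q_0,O,R,\sigma)$ with a total map $\sigma:O\times Q\to R\times Q$. There are $n$ asynchronous processes that may crash. An operation $op$ is an element of $O$ tagged with its caller and a sequence number, and is invoked at most once in a run. A history is a finite or infinite sequence of invocations and responses without duplicates, in which each response is preceded by its invocation and each invocation has at most one response; $op<_H op'$ means that the response of $op$ precedes the invocation of $op'$ in $H$. A completion of $H$ is a history consisting of all complete operations of $H$ and some incomplete operations of $H$ with added responses, which preserves $<_H$. A sequential history $S$ is a linearization of $H$ if $S$ has, for each process, the same subsequence of events as some completion of $H$, $S$ preserves $<_H$, and the responses in $S$ are those prescribed by $\sigma$ from $q_0$. $H$ is linearizable if it has a linearization. A finite sequence of distinct operations is identified with the sequential history in which each operation has the response prescribed by $\sigma$. Two orderings $s,s'$ of the same set of operations are equivalent, $s\simeq s'$, if from $q_0$ they lead to the same state and every operation has the same output in both. For a sequence $l$ and a set $S$ of operations, $op$ commutes in $l$ with $S$ if $l\cdot s\cdot op\simeq l\cdot op\cdot s$ for every ordering $s$ of $S$. **Shared objects.** $G$ is an Announce-Book-Commit Graph: $\mathit{add}_A(op)$,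 $\mathit{add}_B(op,b)$, $\mathit{add}_C(op,M)$ record their arguments, and $\mathit{read}()$ returns $(A,B,C)$, where $A$ is the set of all added operations, $B$ contains for each booked $op$ the pair $(op,b)$ with the minimal added $b$ (its $B$-value), and $C$ contains for each committed $op$ the pair $(op,M)$ with $M$ the union of all sets added for $op$. $C$ is read as a graph with an edge $(op',op)$ whenever $(op,M)\in C$ and $op'\in M$; $V(C)$ is the set of operations that appear in it. $G$ is either an atomic object with this specification, or is implemented from an atomic snapshot object in which each component holds the sets of all pairs and operations added by one process, $\mathit{read}$ being a snapshot followed by merging the components. $K$ is an atomic snapshot object, initially $K[j]=0$ for all $j$, and $\mathit{CONS}_k$ ($k\ge1$) are atomic consensus objects. **The construction.** To execute $op$, process $p_i$ performs $\mathit{publish}(op)$: 1. $G.\mathit{add}_A(op)$; $(A,B,C)\gets G.\mathit{read}()$; $G.\mathit{add}_B(op,|A|)$; $(A,B,C)\gets G.\mathit{read}()$; let $l$ be some topological ordering of $C$. 2. If $op\in V(C)$, return the result of $op$ in $l$. 3. If $op$ commutes in $l$ with every subset of $A\setminus V(C)\setminus\{op\}$, perform $G.\mathit{add}_C(op,V(C))$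 and return the result of $op$ in $l\cdot op$. 4. Otherwise take a snapshot of $K$, let $k$ be the maximum of its components, and repeat: $k\gets k+1$; $(A,B,C)\gets G.\mathit{read}()$; if $op\in V(C)$, return the result of $op$ in some topological ordering of $C$; pick some $\tilde{op}$ of minimal $B$-value among the operations of $B$ not in $V(C)$; $\hat{op}\gets\mathit{CONS}_k.\mathit{propose}(\tilde{op})$; $(A,B,C)\gets G.\mathit{read}()$; if $\hat{op}\notin V(C)$, perform $G.\mathit{add}_C(\hat{op},V(C))$; write $k$ to $K[i]$. A run is any finite or infinite interleaving of the steps of the processes from the initial state, where a step is an invocation, a response, or one operation on a shared object followed by local computation, and each process starts a new operation only after its previous one has returned. It induces the history of invocations and responses of $\mathit{publish}$, with $\mathit{publish}(op)$ identified with $op$. Let $C_t$ be the graph $C$ at time $t$ of the run. **Theorem.** For every sequential object, every $n$ and every run of the construction, the induced history $H$ is linearizable. Moreover, if the graph $C$ has a final value (it is constant from some time on, as in every finite run), then this graph has a topological ordering, and every topological ordering of it is a linearization of $H$. In addition, in every run: - for every $t$, $C_t$ is acyclic and transitive; - when $\mathit{publish}(op)$ returns, $op$ is in $V(C)$; - if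 $op<_H op'$ and $op'\in V(C_t)$, then $op$ precedes $op'$ in every topological ordering of $C_t$; - for every $t$, any two topological orderings of $C_t$ are equivalent; - if $s_1,s_2$ are topological orderings of $C_{t_1},C_{t_2}$ that both contain $op$, then $op$ has the same response in $s_1$ and in $s_2$; - if $op\in V(C_{t_2})$ and $op$ has a response in $H$, then for some $t_1\le t_2$ and some topological ordering $T$ of $C_{t_1}$ that contains $op$, this response is that of $op$ in $T$. -/

import Mathlib

universe u v w

namespace DynConc

/-! ### Sequential objects and sequences of operations -/

/-- A sequential object `(Q, q₀, O, R, σ)` with a total deterministic specification. -/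
structure SeqObject where
  State : Type u
  Op : Type v
  Out : Type w
  start : State
  spec : Op → State → Out × State

/-- An operation as invoked in a run: an element of `O` together with the identifier of its caller
and a sequence number, so that the same element of `O` can be invoked any number of times. -/
structure Operation (n : ℕ) (O : Type v) where
  caller : Fin n
  tag : ℕ
  op : O

namespace SeqObject

/-- The state reached from `q` by applying a sequence of operations. -/
def finalState (X : SeqObject.{u, v, w}) {n : ℕ} :
    X.State → List (Operation n X.Op) → X.State
  | q, [] => q
  | q, o :: l => X.finalState (X.spec o.op q).2 l

/-- The operations of a sequence, each with the output that it returns when the sequence is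
applied from state `q`. -/
def responses (X : SeqObject.{u, v, w}) {n : ℕ} :
    X.State → List (Operation n X.Op) → List (Operation n X.Op × X.Out)
  | _, [] => []
  | q, o :: l => (o, (X.spec o.op q).1) :: X.responses (X.spec o.op q).2 l

/-- `r` is the result of `o` in the sequence `l`, applied from the initial state. -/
def Result (X : SeqObject.{u, v, w}) {n : ℕ} (l : List (Operation n X.Op))
    (o : Operation n X.Op) (r : X.Out) : Prop :=
  (o, r) ∈ X.responses X.start l

end SeqObject

/-- `s` is an ordering of the set `S`. -/
def IsOrdering {α : Type v} (s : List α) (S : Set α) : Prop :=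
  s.Nodup ∧ ∀ x, x ∈ s ↔ x ∈ S

/-- `s ≃ s'`: both are orderings of the same set of operations, they lead from the initial state to
the same state, and every operation returns the same output in both. -/
def EquivSeq (X : SeqObject.{u, v, w}) {n : ℕ} (s s' : List (Operation n X.Op)) : Prop :=
  (∃ S : Set (Operation n X.Op), IsOrdering s S ∧ IsOrdering s' S) ∧
    X.finalState X.start s = X.finalState X.start s' ∧
    ∀ o r, X.Result s o r ↔ X.Result s' o r

/-- `o` commutes in `l` with the set `S`, i.e. with every ordering of `S`. -/
def CommutesIn (X : SeqObject.{u, v, w}) {n : ℕ} (l : List (Operation n X.Op))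
    (o : Operation n X.Op) (S : Set (Operation n X.Op)) : Prop :=
  ∀ s, IsOrdering s S → EquivSeq X (l ++ s ++ [o]) (l ++ [o] ++ s)

/-! ### Histories and linearizability -/

inductive Event (X : SeqObject.{u, v, w}) (n : ℕ) where
  | inv (o : Operation n X.Op)
  | res (o : Operation n X.Op) (r : X.Out)

/-- The process at which an event occurs. -/
def Event.caller {X : SeqObject.{u, v, w}} {n : ℕ} : Event X n → Fin n
  | .inv o => o.caller
  | .res o _ => o.caller

/-- A finite or infinite sequence of events, indexed by discrete time. At a time `t` with
`H t = none` no event takes place; only the order of the events matters. -/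
abbrev EventSeq (X : SeqObject.{u, v, w}) (n : ℕ) := ℕ → Option (Event X n)

namespace EventSeq

variable {X : SeqObject.{u, v, w}} {n : ℕ}

def Occurs (H : EventSeq X n) (e : Event X n) : Prop := ∃ t, H t = some e

/-- No duplicates, every response is preceded by its invocation, and every invocation has at most
one response. -/
def IsHistory (H : EventSeq X n) : Prop :=
  (∀ i j e, H i = some e → H j = some e → i = j) ∧
  (∀ j o r, H j = some (.res o r) → ∃ i < j, H i = some (.inv o)) ∧
  (∀ i j o r r', H i = some (.res o r) → H j = some (.res o r') → i = j)

/-- The precedence relation: the response of `o` precedes the invocation of `o'`. -/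
def Precedes (H : EventSeq X n) (o o' : Operation n X.Op) : Prop :=
  ∃ i j r, i < j ∧ H i = some (.res o r) ∧ H j = some (.inv o')

/-- `H'` preserves the precedence relation of `H` (among the operations of `H'`). -/
def PreservesPrecedence (H H' : EventSeq X n) : Prop :=
  ∀ o o', H'.Occurs (.inv o) → H'.Occurs (.inv o') → H.Precedes o o' → H'.Precedes o o'

/-- `H'` consists of all complete operations of `H` (with their responses in `H`) and some
incomplete operations of `H`, each with a response, and preserves the precedence relation. -/
def IsCompletion (H H' : EventSeq X n) : Prop :=
  H'.IsHistory ∧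
  (∀ o r, H.Occurs (.res o r) → H'.Occurs (.res o r)) ∧
  (∀ o, H'.Occurs (.inv o) → H.Occurs (.inv o) ∧ ∃ r, H'.Occurs (.res o r)) ∧
  H.PreservesPrecedence H'

/-- `H | p` -/
def proj (H : EventSeq X n) (p : Fin n) : EventSeq X n :=
  fun t => (H t).filter fun e => decide (e.caller = p)

/-- `H` and `H'` list the same events in the same order. -/
def SameSeq (H H' : EventSeq X n) : Prop :=
  ∃ f : {t // (H t).isSome} ≃o {t // (H' t).isSome}, ∀ t, H' (f t) = H t

/-- Equivalence of histories: `H | p = H' | p` for all processes `p`. -/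
def Equivalent (H H' : EventSeq X n) : Prop :=
  ∀ p, (H.proj p).SameSeq (H'.proj p)

/-- An invocation can only be followed by its response. -/
def IsSequential (S : EventSeq X n) : Prop :=
  S.IsHistory ∧
  ∀ i j o e, i < j → S i = some (.inv o) → (∀ k, i < k → k < j → S k = none) →
    S j = some e → ∃ r, e = .res o r

/-- The state of the object before time `t`, when operations are applied as they respond. -/
def stateAt (S : EventSeq X n) : ℕ → X.State
  | 0 => X.start
  | t + 1 =>
    match S t with
    | some (.res o _) => (X.spec o.op (S.stateAt t)).2
    | _ => S.stateAt t

/-- A sequential history is legal if the recorded responses are those of the specification. -/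
def IsLegal (S : EventSeq X n) : Prop :=
  ∀ t o r, S t = some (.res o r) → r = (X.spec o.op (S.stateAt t)).1

/-- `S` is a linearization of `H`. -/
def IsLinearization (H S : EventSeq X n) : Prop :=
  S.IsSequential ∧ (∃ H', H.IsCompletion H' ∧ S.Equivalent H') ∧
    H.PreservesPrecedence S ∧ S.IsLegal

def Linearizable (H : EventSeq X n) : Prop := ∃ S, H.IsLinearization S

end EventSeq

/-- A finite sequence of operations as a sequential history, in which every operation has the
response prescribed by the sequential specification. -/
def seqHistory (X : SeqObject.{u, v, w}) {n : ℕ} (s : List (Operation n X.Op)) : EventSeq X n :=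
  fun t => ((X.responses X.start s).flatMap fun x => [Event.inv x.1, Event.res x.1 x.2])[t]?

/-! ### Dependency graphs -/

/-- A graph of operations, encoded as a set of tuples `(op, M)`, where `M` is the set of operations
that have outgoing edges to `op`. -/
abbrev DepGraph (n : ℕ) (O : Type v) := Set (Operation n O × Set (Operation n O))

namespace DepGraph

variable {n : ℕ} {O : Type v}

/-- The operations that appear in the graph, in either part of a tuple. -/
def vertices (C : DepGraph n O) : Set (Operation n O) :=
  {o | ∃ x ∈ C, o = x.1 ∨ o ∈ x.2}

/-- There is an edge from `o` to `o'`. -/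
def Edge (C : DepGraph n O) (o o' : Operation n O) : Prop :=
  ∃ M, (o', M) ∈ C ∧ o ∈ M

def Acyclic (C : DepGraph n O) : Prop := ∀ o, ¬ Relation.TransGen C.Edge o o

/-- `s` is a topological ordering of the graph; `[o, o'] <+ s` says that `o` precedes `o'` in
`s`. -/
def IsTopOrder (C : DepGraph n O) (s : List (Operation n O)) : Prop :=
  IsOrdering s C.vertices ∧ ∀ o o', C.Edge o o' → List.Sublist [o, o'] s

end DepGraph

/-! ### The Announce-Book-Commit Graph -/

/-- A triple `(A, B, C)`. -/
structure Triple (n : ℕ) (O : Type v) where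
  A : Set (Operation n O)
  B : Set (Operation n O × ℕ)
  C : DepGraph n O

namespace Triple

variable {n : ℕ} {O : Type v}

def empty : Triple n O := ⟨∅, ∅, ∅⟩

/-- Group by operation and merge: minimum of the integers in `B`, union of the sets in `C`. -/
def merge (T : Triple n O) : Triple n O where
  A := T.A
  B := {x | x ∈ T.B ∧ ∀ b, (x.1, b) ∈ T.B → x.2 ≤ b}
  C := {x | (∃ M, (x.1, M) ∈ T.C) ∧ x.2 = ⋃₀ {M | (x.1, M) ∈ T.C}}

end Triple

/-- A shared object with the interface of the ABC Graph, every operation of which (called by a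
process `i : Fin n`) takes effect in one step. -/
structure GraphObject (n : ℕ) (O : Type v) where
  State : Type v
  start : State
  addA : Fin n → Operation n O → State → State
  addB : Fin n → Operation n O → ℕ → State → State
  addC : Fin n → Operation n O → Set (Operation n O) → State → State
  read : State → Triple n O

/-- The ABC Graph as specified: the state records all preceding `add` operations, and `read`
returns, for each booked operation, its minimal integer, and for each committed operation, the
union of its sets. -/
def abcGraph (n : ℕ) (O : Type v) : GraphObject n O where
  State := Triple n O
  start := Triple.empty
  addA := fun _ o T => { T with A := T.A ∪ {o} }
  addB := fun _ o b T => { T with B := T.B ∪ {(o, b)} }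
  addC := fun _ o M T => { T with C := T.C ∪ {(o, M)} }
  read := Triple.merge

/-- The local variables `(R_A, R_B, R_C)` of every process and the snapshot object with components
`(S_A[j], S_B[j], S_C[j])`. -/
structure SnapshotState (n : ℕ) (O : Type v) where
  R : Fin n → Triple n O
  S : Fin n → Triple n O

/-- The implementation of the ABC Graph from a snapshot object: every `add` extends a local variable
and writes it to the caller's component, and `read` takes a snapshot and merges the components. -/
def abcFromSnapshot (n : ℕ) (O : Type v) : GraphObject n O where
  State := SnapshotState n O
  start := ⟨fun _ => Triple.empty, fun _ => Triple.empty⟩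
  addA := fun i o σ =>
    let RA := (σ.R i).A ∪ {o}
    ⟨Function.update σ.R i { σ.R i with A := RA }, Function.update σ.S i { σ.S i with A := RA }⟩
  addB := fun i o b σ =>
    let RB := (σ.R i).B ∪ {(o, b)}
    ⟨Function.update σ.R i { σ.R i with B := RB }, Function.update σ.S i { σ.S i with B := RB }⟩
  addC := fun i o M σ =>
    let RC := (σ.R i).C ∪ {(o, M)}
    ⟨Function.update σ.R i { σ.R i with C := RC }, Function.update σ.S i { σ.S i with C := RC }⟩
  read := fun σ => Triple.merge ⟨⋃ j, (σ.S j).A, ⋃ j, (σ.S j).B, ⋃ j, (σ.S j).C⟩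

/-! ### The universal construction -/

/-- The local state of a process: `idle`, or executing `publish(o)` with the next operation on a
shared object (or the response of `publish(o)`) given by the constructor. -/
inductive Local (X : SeqObject.{u, v, w}) (n : ℕ) where
  | idle
  /-- next: `G.add_A(o)` -/
  | announce (o : Operation n X.Op)
  /-- next: the first `G.read()` -/
  | read₁ (o : Operation n X.Op)
  /-- next: `G.add_B(o, b)` -/
  | book (o : Operation n X.Op) (b : ℕ)
  /-- next: the second `G.read()` -/
  | read₂ (o : Operation n X.Op)
  /-- next: `G.add_C(o, M)` on the conflict-free path, then return `r` -/
  | commit (o : Operation n X.Op) (M : Set (Operation n X.Op)) (r : X.Out)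
  /-- conflict resolution; next: `K.snapshot()` -/
  | snapK (o : Operation n X.Op)
  /-- iteration `k`; next: the first `G.read()` of the loop -/
  | loopRead₁ (o : Operation n X.Op) (k : ℕ)
  /-- iteration `k`; next: `CONS_k.propose(õ)` -/
  | propose (o : Operation n X.Op) (k : ℕ) (õ : Operation n X.Op)
  /-- iteration `k`, `CONS_k` returned `ô`; next: the second `G.read()` of the loop -/
  | loopRead₂ (o : Operation n X.Op) (k : ℕ) (ô : Operation n X.Op)
  /-- iteration `k`; next: `G.add_C(ô, M)` -/
  | loopCommit (o : Operation n X.Op) (k : ℕ) (ô : Operation n X.Op) (M : Set (Operation n X.Op))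
  /-- iteration `k`; next: `K[i].write(k)` -/
  | writeK (o : Operation n X.Op) (k : ℕ)
  /-- next: return `r` -/
  | respond (o : Operation n X.Op) (r : X.Out)

/-- A global state: the graph object `G`, the snapshot object `K`, the consensus objects `CONS_k`
(with the value that each stores), and the local states of the processes. -/
structure Config (X : SeqObject.{u, v, w}) {n : ℕ} (G : GraphObject n X.Op) where
  graph : G.State
  K : Fin n → ℕ
  cons : ℕ → Option (Operation n X.Op)
  loc : Fin n → Local X n

namespace Config

variable {X : SeqObject.{u, v, w}} {n : ℕ} {G : GraphObject n X.Op}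

def start : Config X G := ⟨G.start, fun _ => 0, fun _ => none, fun _ => .idle⟩

/-- The triple `(A, B, C)` that a `G.read()` returns. -/
def abc (c : Config X G) : Triple n X.Op := G.read c.graph

/-- Process `i` moves to the local state `a`. -/
def goto (c : Config X G) (i : Fin n) (a : Local X n) : Config X G :=
  { c with loc := Function.update c.loc i a }

end Config

/-- The commutativity test: every subset of `A - vertices(C) - {o}` commutes with `o` in `l`. -/
def CommutesWithConcurrent (X : SeqObject.{u, v, w}) {n : ℕ} (T : Triple n X.Op)
    (l : List (Operation n X.Op)) (o : Operation n X.Op) : Prop :=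
  ∀ S, S ⊆ (T.A \ T.C.vertices) \ {o} → CommutesIn X l o S

/-- `o` has minimal `B`-value among the operations of `B` that are not vertices of `C`. -/
def IsArgMin {n : ℕ} {O : Type v} (T : Triple n O) (o : Operation n O) : Prop :=
  ∃ b, (o, b) ∈ T.B ∧ o ∉ T.C.vertices ∧
    ∀ o' b', (o', b') ∈ T.B → o' ∉ T.C.vertices → b ≤ b'

/-- The steps of process `i` executing the dynamically concurrent universal construction. A step
is the invocation or the response of an operation, or a single operation on a shared object
followed by the local computation up to the next one. The topological ordering returned by
`linearize` and the element of the `arg min` are arbitrary. -/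
inductive Step {X : SeqObject.{u, v, w}} {n : ℕ} {G : GraphObject n X.Op} (i : Fin n) :
    Config X G → Option (Event X n) → Config X G → Prop
  | invoke (c : Config X G) (o : Operation n X.Op) (hc : c.loc i = .idle) (hi : o.caller = i) :
      Step i c (some (.inv o)) (c.goto i (.announce o))
  | announce (c : Config X G) (o : Operation n X.Op) (hc : c.loc i = .announce o) :
      Step i c none ({ c with graph := G.addA i o c.graph }.goto i (.read₁ o))
  | read₁ (c : Config X G) (o : Operation n X.Op) (hc : c.loc i = .read₁ o) :
      Step i c none (c.goto i (.book o c.abc.A.ncard))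
  | book (c : Config X G) (o : Operation n X.Op) (b : ℕ) (hc : c.loc i = .book o b) :
      Step i c none ({ c with graph := G.addB i o b c.graph }.goto i (.read₂ o))
  | read₂_committed (c : Config X G) (o : Operation n X.Op) (l : List (Operation n X.Op))
      (r : X.Out) (hc : c.loc i = .read₂ o) (hl : c.abc.C.IsTopOrder l)
      (ho : o ∈ c.abc.C.vertices) (hr : X.Result l o r) :
      Step i c none (c.goto i (.respond o r))
  | read₂_commutes (c : Config X G) (o : Operation n X.Op) (l : List (Operation n X.Op))
      (r : X.Out) (hc : c.loc i = .read₂ o) (hl : c.abc.C.IsTopOrder l)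
      (ho : o ∉ c.abc.C.vertices) (hcomm : CommutesWithConcurrent X c.abc l o)
      (hr : X.Result (l ++ [o]) o r) :
      Step i c none (c.goto i (.commit o c.abc.C.vertices r))
  | read₂_conflict (c : Config X G) (o : Operation n X.Op) (l : List (Operation n X.Op))
      (hc : c.loc i = .read₂ o) (hl : c.abc.C.IsTopOrder l)
      (ho : o ∉ c.abc.C.vertices) (hcomm : ¬ CommutesWithConcurrent X c.abc l o) :
      Step i c none (c.goto i (.snapK o))
  | commit (c : Config X G) (o : Operation n X.Op) (M : Set (Operation n X.Op)) (r : X.Out)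
      (hc : c.loc i = .commit o M r) :
      Step i c none ({ c with graph := G.addC i o M c.graph }.goto i (.respond o r))
  | snapK (c : Config X G) (o : Operation n X.Op) (hc : c.loc i = .snapK o) :
      Step i c none (c.goto i (.loopRead₁ o (Finset.univ.sup c.K + 1)))
  | loopRead₁_committed (c : Config X G) (o : Operation n X.Op) (k : ℕ)
      (l : List (Operation n X.Op)) (r : X.Out) (hc : c.loc i = .loopRead₁ o k)
      (ho : o ∈ c.abc.C.vertices) (hl : c.abc.C.IsTopOrder l) (hr : X.Result l o r) :
      Step i c none (c.goto i (.respond o r))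
  | loopRead₁_select (c : Config X G) (o : Operation n X.Op) (k : ℕ) (õ : Operation n X.Op)
      (hc : c.loc i = .loopRead₁ o k) (ho : o ∉ c.abc.C.vertices) (hmin : IsArgMin c.abc õ) :
      Step i c none (c.goto i (.propose o k õ))
  | propose_first (c : Config X G) (o : Operation n X.Op) (k : ℕ) (õ : Operation n X.Op)
      (hc : c.loc i = .propose o k õ) (hk : c.cons k = none) :
      Step i c none
        ({ c with cons := Function.update c.cons k (some õ) }.goto i (.loopRead₂ o k õ))
  | propose_later (c : Config X G) (o : Operation n X.Op) (k : ℕ) (õ ô : Operation n X.Op)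
      (hc : c.loc i = .propose o k õ) (hk : c.cons k = some ô) :
      Step i c none (c.goto i (.loopRead₂ o k ô))
  | loopRead₂_committed (c : Config X G) (o : Operation n X.Op) (k : ℕ) (ô : Operation n X.Op)
      (hc : c.loc i = .loopRead₂ o k ô) (hô : ô ∈ c.abc.C.vertices) :
      Step i c none (c.goto i (.writeK o k))
  | loopRead₂_uncommitted (c : Config X G) (o : Operation n X.Op) (k : ℕ) (ô : Operation n X.Op)
      (hc : c.loc i = .loopRead₂ o k ô) (hô : ô ∉ c.abc.C.vertices) :
      Step i c none (c.goto i (.loopCommit o k ô c.abc.C.vertices))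
  | loopCommit (c : Config X G) (o : Operation n X.Op) (k : ℕ) (ô : Operation n X.Op)
      (M : Set (Operation n X.Op)) (hc : c.loc i = .loopCommit o k ô M) :
      Step i c none ({ c with graph := G.addC i ô M c.graph }.goto i (.writeK o k))
  | writeK (c : Config X G) (o : Operation n X.Op) (k : ℕ) (hc : c.loc i = .writeK o k) :
      Step i c none ({ c with K := Function.update c.K i k }.goto i (.loopRead₁ o (k + 1)))
  | respond (c : Config X G) (o : Operation n X.Op) (r : X.Out) (hc : c.loc i = .respond o r) :
      Step i c (some (.res o r)) (c.goto i .idle)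

/-- A finite or infinite run with `n` processes: at every time at most one process takes a step, and
a finite run is one in which no step is taken from some time on. Every operation is invoked at most
once. -/
structure Run (X : SeqObject.{u, v, w}) {n : ℕ} (G : GraphObject n X.Op) where
  cfg : ℕ → Config X G
  /-- the induced history -/
  history : EventSeq X n
  cfg_zero : cfg 0 = Config.start
  step : ∀ t, (∃ i, Step i (cfg t) (history t) (cfg (t + 1))) ∨
    (history t = none ∧ cfg (t + 1) = cfg t)
  unique : ∀ s t o, history s = some (.inv o) → history t = some (.inv o) → s = t

/-- The dependency graph `C` at time `t`. -/
def Run.C {X : SeqObject.{u, v, w}} {n : ℕ} {G : GraphObject n X.Op} (ρ : Run X G) (t : ℕ) :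
    DepGraph n X.Op :=
  (ρ.cfg t).abc.C

end DynConc

/-! Every record `(op, M)` in `C` stems from a single read at some time s: `M` is the vertex set `V
s`, and `op` is already announced but not in `V s` (`exists_of_mem_C`). As `V` only grows, an edge
from a to b at any time forces a into every `V u` that contains b (`mem_V_of_edge`). So each `V u`
is closed under predecessors, even those added later. Transitivity and acyclicity follow. Real-time
order follows as well, because an operation is committed when it returns, hence before any later
invocation is announced.

Call an operation fast if one of its records comes from passing the commutativity test, and slow
otherwise. Slow operations are totally ordered, since an iteration starts only when all earlier
decisions are committed. A slow operation that was unannounced at the test of a fast one has a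
strictly larger booked value, so it is ordered after the fast one (`edge_of_not_mem_A`).

Equivalence of topological orderings is proved by induction on time and, at a fixed time, on the
length of a linear extension (`linExt_spec`). If some slow operation lies after all fast ones, the
last element is forced and can be removed. Otherwise every operation present was announced by the
latest test; the operation x of that test therefore commutes with everything it had not seen
committed, and it can be moved to the end (`LinExt.move_to_end`). The same argument shows that x
keeps the response computed at its test.

Since `V t₁` can be put first in an ordering of a later graph, responses never change. The order of
first commits is a topological ordering at all times and grows by prefixes, which linearizes
infinite runs too. The snapshot-based graph is simulated by the atomic one. -/

namespace DynConc

/-! ### Equivalence of sequences -/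

section Sequences

variable {X : SeqObject.{u, v, w}} {n : ℕ}

theorem finalState_append (q : X.State) (s s' : List (Operation n X.Op)) :
    X.finalState q (s ++ s') = X.finalState (X.finalState q s) s' := by
  induction s generalizing q with
  | nil => rfl
  | cons a s ih => exact ih _

theorem responses_append (q : X.State) (s s' : List (Operation n X.Op)) :
    X.responses q (s ++ s') = X.responses q s ++ X.responses (X.finalState q s) s' := by
  induction s generalizing q with
  | nil => rfl
  | cons a s ih => simp [SeqObject.responses, SeqObject.finalState, ih]

theorem map_fst_responses (q : X.State) (s : List (Operation n X.Op)) :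
    (X.responses q s).map Prod.fst = s := by
  induction s generalizing q with
  | nil => rfl
  | cons a s ih => simp [SeqObject.responses, ih]

theorem result_append {s s' : List (Operation n X.Op)} {o : Operation n X.Op} {r : X.Out} :
    X.Result (s ++ s') o r ↔
      X.Result s o r ∨ (o, r) ∈ X.responses (X.finalState X.start s) s' := by
  simp [SeqObject.Result, responses_append]

theorem Result.mem {s : List (Operation n X.Op)} {o : Operation n X.Op} {r : X.Out}
    (h : X.Result s o r) : o ∈ s := by
  have := List.mem_map_of_mem (f := Prod.fst) h
  rwa [map_fst_responses] at this

theorem exists_result {s : List (Operation n X.Op)} {o : Operation n X.Op} (h : o ∈ s) :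
    ∃ r, X.Result s o r := by
  rw [← map_fst_responses X.start s] at h
  obtain ⟨⟨_, r⟩, hr, rfl⟩ := List.mem_map.1 h
  exact ⟨r, hr⟩

theorem Result.unique {s : List (Operation n X.Op)} {o : Operation n X.Op} {r r' : X.Out}
    (hs : s.Nodup) (h : X.Result s o r) (h' : X.Result s o r') : r = r' := by
  have hn : ((X.responses X.start s).map Prod.fst).Nodup := by rwa [map_fst_responses]
  exact congrArg Prod.snd (List.inj_on_of_nodup_map hn h h' rfl)

/-- Equivalence of sequences, with equality of the underlying sets expressed by a permutation. -/
def SeqEqv (X : SeqObject.{u, v, w}) {n : ℕ} (s s' : List (Operation n X.Op)) : Prop :=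
  s.Perm s' ∧ X.finalState X.start s = X.finalState X.start s' ∧
    ∀ o r, X.Result s o r ↔ X.Result s' o r

namespace SeqEqv

variable {s s' s'' : List (Operation n X.Op)}

theorem refl (s : List (Operation n X.Op)) : SeqEqv X s s := ⟨.refl _, rfl, fun _ _ => .rfl⟩

theorem symm (h : SeqEqv X s s') : SeqEqv X s' s :=
  ⟨h.1.symm, h.2.1.symm, fun o r => (h.2.2 o r).symm⟩

theorem trans (h : SeqEqv X s s') (h' : SeqEqv X s' s'') : SeqEqv X s s'' :=
  ⟨h.1.trans h'.1, h.2.1.trans h'.2.1, fun o r => (h.2.2 o r).trans (h'.2.2 o r)⟩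

/-- Equivalence refers to the initial state only, so it is preserved by appending on the right but
not by prepending. Later rearrangements therefore act on prefixes. -/
theorem append_right (h : SeqEqv X s s') (q : List (Operation n X.Op)) :
    SeqEqv X (s ++ q) (s' ++ q) := by
  refine ⟨h.1.append_right q, ?_, fun o r => ?_⟩
  · rw [finalState_append, finalState_append, h.2.1]
  · rw [result_append, result_append, h.2.2, h.2.1]

theorem equivSeq (h : SeqEqv X s s') (hs : s.Nodup) : EquivSeq X s s' :=
  ⟨⟨{o | o ∈ s}, ⟨hs, fun _ => .rfl⟩, ⟨h.1.nodup hs, fun _ => h.1.mem_iff.symm⟩⟩, h.2⟩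

end SeqEqv

theorem IsOrdering.perm {α : Type v} {s s' : List α} {S : Set α} (h : IsOrdering s S)
    (h' : IsOrdering s' S) : s.Perm s' :=
  (List.perm_ext_iff_of_nodup h.1 h'.1).2 fun a => (h.2 a).trans (h'.2 a).symm

theorem EquivSeq.seqEqv {s s' : List (Operation n X.Op)} (h : EquivSeq X s s') :
    SeqEqv X s s' := by
  obtain ⟨⟨S, h₁, h₂⟩, h⟩ := h
  exact ⟨h₁.perm h₂, h⟩

end Sequences

/-! ### Precedence in duplicate-free lists. -/

section Lists

variable {α : Type v}

theorem not_sublist_pair_swap {s : List α} {a b : α} (hs : s.Nodup) (h : List.Sublist [a, b] s) :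
    ¬ List.Sublist [b, a] s := by
  intro h'
  induction s with
  | nil => simp at h
  | cons c s ih =>
    obtain ⟨hc, hs⟩ := List.nodup_cons.1 hs
    rcases List.sublist_cons_iff.1 h with h1 | ⟨r, hr, h1⟩ <;>
    rcases List.sublist_cons_iff.1 h' with h2 | ⟨r', hr', h2⟩
    · exact ih hs h1 h2
    · simp at hr'
      exact hc (h1.subset (by simp [← hr'.1]))
    · simp at hr
      exact hc (h2.subset (by simp [← hr.1]))
    · simp at hr hr'
      obtain ⟨rfl, rfl⟩ := hr
      exact hc (h1.subset (by simp [hr'.1]))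

theorem sublist_pair_or_swap {s : List α} {a b : α} (ha : a ∈ s) (hb : b ∈ s) (hab : a ≠ b) :
    List.Sublist [a, b] s ∨ List.Sublist [b, a] s := by
  obtain ⟨p, q, rfl⟩ := List.append_of_mem ha
  simp only [List.mem_append, List.mem_cons] at hb
  rcases hb with hb | hb | hb
  · right
    exact (List.singleton_sublist.2 hb).append (List.singleton_sublist.2 (by simp))
  · exact absurd hb.symm hab
  · left
    exact List.Sublist.trans (List.Sublist.cons_cons a (List.singleton_sublist.2 hb))
      (List.sublist_append_right p _)

/-- The absence of backward edges, unlike the presence of forward ones, passes to sublists and can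
be checked blockwise on a concatenation. -/
theorem isTopOrder_iff_pairwise {n : ℕ} {O : Type v} {C : DepGraph n O}
    {s : List (Operation n O)} (hs : IsOrdering s C.vertices) (hne : ∀ o, ¬ C.Edge o o) :
    C.IsTopOrder s ↔ s.Pairwise fun a b => ¬ C.Edge b a := by
  rw [List.pairwise_iff_forall_sublist]
  refine ⟨fun h a b hab hba => not_sublist_pair_swap hs.1 hab (h.2 _ _ hba),
    fun h => ⟨hs, fun a b hab => ?_⟩⟩
  obtain ⟨M, hM, ha⟩ := id hab
  have hne' : a ≠ b := by
    rintro rfl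
    exact hne _ hab
  refine (sublist_pair_or_swap ((hs.2 a).2 ⟨_, hM, .inr ha⟩) ((hs.2 b).2 ⟨_, hM, .inl rfl⟩)
    hne').resolve_right fun h' => h h' hab

end Lists

/-! ### Sequential histories given by an enumeration of operations -/

section Enumeration

variable {X : SeqObject.{u, v, w}} {n : ℕ}

/-- The sequential history in which the operations enumerated by `f` are executed in order. -/
def enumHistory (f : ℕ → Option (Operation n X.Op × X.Out)) : EventSeq X n := fun t =>
  if t % 2 = 0 then (f (t / 2)).map fun x => Event.inv x.1
  else (f (t / 2)).map fun x => Event.res x.1 x.2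

/-- The state before the `j`-th operation of an enumeration. -/
def enumState (f : ℕ → Option (Operation n X.Op × X.Out)) : ℕ → X.State
  | 0 => X.start
  | j + 1 =>
    match f j with
    | some x => (X.spec x.1.op (enumState f j)).2
    | none => enumState f j

variable {f : ℕ → Option (Operation n X.Op × X.Out)}

theorem enumHistory_even (j : ℕ) :
    enumHistory f (2 * j) = (f j).map fun x => Event.inv x.1 := by
  simp [enumHistory]

theorem enumHistory_odd (j : ℕ) :
    enumHistory f (2 * j + 1) = (f j).map fun x => Event.res x.1 x.2 := by
  have h1 : (2 * j + 1) % 2 ≠ 0 := by omega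
  have h2 : (2 * j + 1) / 2 = j := by omega
  simp [enumHistory, h2, Nat.add_mod]

theorem enumHistory_eq_inv {t : ℕ} {o : Operation n X.Op} :
    enumHistory f t = some (.inv o) ↔ ∃ j r, t = 2 * j ∧ f j = some (o, r) := by
  obtain ⟨j, rfl | rfl⟩ : ∃ j, t = 2 * j ∨ t = 2 * j + 1 := ⟨t / 2, by omega⟩
  · rw [enumHistory_even]
    constructor
    · intro h
      obtain ⟨⟨o', r⟩, hx, h⟩ := Option.map_eq_some_iff.1 h
      cases h
      exact ⟨j, r, rfl, hx⟩
    · rintro ⟨j', r, hj, h⟩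
      obtain rfl : j = j' := by omega
      simp [h]
  · rw [enumHistory_odd]
    constructor
    · intro h
      obtain ⟨x, hx, h⟩ := Option.map_eq_some_iff.1 h
      cases h
    · rintro ⟨j', r, hj, h⟩
      omega

theorem enumHistory_eq_res {t : ℕ} {o : Operation n X.Op} {r : X.Out} :
    enumHistory f t = some (.res o r) ↔ ∃ j, t = 2 * j + 1 ∧ f j = some (o, r) := by
  obtain ⟨j, rfl | rfl⟩ : ∃ j, t = 2 * j ∨ t = 2 * j + 1 := ⟨t / 2, by omega⟩
  · rw [enumHistory_even]
    constructor
    · intro h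
      obtain ⟨x, hx, h⟩ := Option.map_eq_some_iff.1 h
      cases h
    · rintro ⟨j', hj, h⟩
      omega
  · rw [enumHistory_odd]
    constructor
    · intro h
      obtain ⟨⟨o', r'⟩, hx, h⟩ := Option.map_eq_some_iff.1 h
      cases h
      exact ⟨j, rfl, hx⟩
    · rintro ⟨j', hj, h⟩
      obtain rfl : j = j' := by omega
      simp [h]

theorem stateAt_enumHistory (j : ℕ) :
    (enumHistory f).stateAt (2 * j) = enumState f j ∧
      (enumHistory f).stateAt (2 * j + 1) = enumState f j := by
  have key : ∀ j, (enumHistory f).stateAt (2 * j) = enumState f j →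
      (enumHistory f).stateAt (2 * j + 1) = enumState f j := by
    intro j h
    rw [EventSeq.stateAt, enumHistory_even]
    cases f j <;> simpa using h
  induction j with
  | zero => exact ⟨rfl, key 0 rfl⟩
  | succ j ih =>
    have : (enumHistory f).stateAt (2 * (j + 1)) = enumState f (j + 1) := by
      rw [show 2 * (j + 1) = 2 * j + 1 + 1 by ring, EventSeq.stateAt, enumHistory_odd, enumState]
      cases f j <;> simp [ih.2]
    exact ⟨this, key _ this⟩

/-- An enumeration of operations of `H` is a linearization of `H` if it includes all complete
operations with their responses, respects the precedence relation, and is legal. -/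
theorem isLinearization_enumHistory {H : EventSeq X n}
    (hinj : ∀ i j o r r', f i = some (o, r) → f j = some (o, r') → i = j)
    (hinv : ∀ i o r, f i = some (o, r) → H.Occurs (.inv o))
    (hres : ∀ o r, H.Occurs (.res o r) → ∃ i, f i = some (o, r))
    (hprec : ∀ o o', H.Precedes o o' → ∀ i j r r', f i = some (o, r) → f j = some (o', r') → i < j)
    (hlegal : ∀ j o r, f j = some (o, r) → r = (X.spec o.op (enumState f j)).1) :
    H.IsLinearization (enumHistory f) := by
  have hhist : (enumHistory f).IsHistory := by
    refine ⟨?_, ?_, ?_⟩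
    · rintro i j (o | ⟨o, r⟩) hi hj
      · obtain ⟨i, r, rfl, hfi⟩ := enumHistory_eq_inv.1 hi
        obtain ⟨j, r', rfl, hfj⟩ := enumHistory_eq_inv.1 hj
        rw [hinj _ _ _ _ _ hfi hfj]
      · obtain ⟨i, rfl, hfi⟩ := enumHistory_eq_res.1 hi
        obtain ⟨j, rfl, hfj⟩ := enumHistory_eq_res.1 hj
        rw [hinj _ _ _ _ _ hfi hfj]
    · intro j o r hj
      obtain ⟨j, rfl, hfj⟩ := enumHistory_eq_res.1 hj
      exact ⟨2 * j, by omega, enumHistory_eq_inv.2 ⟨j, r, rfl, hfj⟩⟩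
    · intro i j o r r' hi hj
      obtain ⟨i, rfl, hfi⟩ := enumHistory_eq_res.1 hi
      obtain ⟨j, rfl, hfj⟩ := enumHistory_eq_res.1 hj
      rw [hinj _ _ _ _ _ hfi hfj]
  have hpres : H.PreservesPrecedence (enumHistory f) := by
    rintro o o' ⟨t, ht⟩ ⟨t', ht'⟩ h
    obtain ⟨i, r, rfl, hfi⟩ := enumHistory_eq_inv.1 ht
    obtain ⟨j, r', rfl, hfj⟩ := enumHistory_eq_inv.1 ht'
    have := hprec o o' h i j r r' hfi hfj
    exact ⟨2 * i + 1, 2 * j, r, by omega, enumHistory_eq_res.2 ⟨i, rfl, hfi⟩, ht'⟩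
  -- The sequential history serves as its own completion, so equivalence is witnessed by the
  -- identity.
  refine ⟨⟨hhist, ?_⟩, ⟨enumHistory f, ⟨hhist, ?_, ?_, hpres⟩, ?_⟩, hpres, ?_⟩
  · intro i j o e hij hi hbetween hj
    obtain ⟨i, r, rfl, hfi⟩ := enumHistory_eq_inv.1 hi
    have hodd : enumHistory f (2 * i + 1) = some (.res o r) := enumHistory_eq_res.2 ⟨i, rfl, hfi⟩
    obtain rfl | hlt : j = 2 * i + 1 ∨ 2 * i + 1 < j := by omega
    · rw [hodd] at hj
      exact ⟨r, (Option.some.inj hj).symm⟩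
    · rw [hbetween (2 * i + 1) (by omega) hlt] at hodd
      cases hodd
  · intro o r h
    obtain ⟨i, hfi⟩ := hres o r h
    exact ⟨2 * i + 1, enumHistory_eq_res.2 ⟨i, rfl, hfi⟩⟩
  · rintro o ⟨t, ht⟩
    obtain ⟨i, r, rfl, hfi⟩ := enumHistory_eq_inv.1 ht
    exact ⟨hinv i o r hfi, r, 2 * i + 1, enumHistory_eq_res.2 ⟨i, rfl, hfi⟩⟩
  · exact fun p => ⟨OrderIso.refl _, fun t => rfl⟩
  · intro t o r ht
    obtain ⟨j, rfl, hfj⟩ := enumHistory_eq_res.1 ht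
    rw [(stateAt_enumHistory j).2]
    exact hlegal j o r hfj

theorem seqHistory_eq_enumHistory (s : List (Operation n X.Op)) :
    seqHistory X s = enumHistory fun j => (X.responses X.start s)[j]? := by
  have key : ∀ (L : List (Operation n X.Op × X.Out)) (j : ℕ),
      (L.flatMap fun x => [Event.inv (X := X) x.1, Event.res x.1 x.2])[2 * j]? =
          (L[j]?).map (fun x => Event.inv x.1) ∧
        (L.flatMap fun x => [Event.inv (X := X) x.1, Event.res x.1 x.2])[2 * j + 1]? =
          (L[j]?).map fun x => Event.res x.1 x.2 := by
    intro L
    induction L with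
    | nil => simp
    | cons a L ih =>
      rintro (_ | j)
      · simp
      · simpa [Nat.mul_add] using ih j
  funext t
  obtain ⟨j, rfl | rfl⟩ : ∃ j, t = 2 * j ∨ t = 2 * j + 1 := ⟨t / 2, by omega⟩
  · rw [enumHistory_even]
    exact (key _ j).1
  · rw [enumHistory_odd]
    exact (key _ j).2

theorem responses_getElem?_eq {q : X.State} {s : List (Operation n X.Op)} {j : ℕ}
    {o : Operation n X.Op} {r : X.Out} :
    (X.responses q s)[j]? = some (o, r) ↔
      s[j]? = some o ∧ r = (X.spec o.op (X.finalState q (s.take j))).1 := by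
  induction s generalizing q j with
  | nil => simp [SeqObject.responses]
  | cons a s ih =>
    cases j with
    | zero =>
      simp only [SeqObject.responses, List.getElem?_cons_zero, Option.some.injEq, Prod.mk.injEq,
        List.take_zero, SeqObject.finalState]
      constructor
      · rintro ⟨rfl, rfl⟩
        exact ⟨rfl, rfl⟩
      · rintro ⟨rfl, rfl⟩
        exact ⟨rfl, rfl⟩
    | succ j => simpa [SeqObject.responses, SeqObject.finalState] using ih

theorem enumState_responses (s : List (Operation n X.Op)) (j : ℕ) :
    enumState (fun j => (X.responses X.start s)[j]?) j = X.finalState X.start (s.take j) := by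
  induction j with
  | zero => rfl
  | succ j ih =>
    rw [enumState]
    have hlen : (X.responses X.start s).length = s.length := by
      rw [← List.length_map (f := Prod.fst), map_fst_responses]
    cases h : (X.responses X.start s)[j]? with
    | none =>
      have : s.length ≤ j := by rw [← hlen]; simpa using h
      simp only [ih]
      rw [List.take_of_length_le this, List.take_of_length_le (by omega)]
    | some x =>
      obtain ⟨h, -⟩ := responses_getElem?_eq (o := x.1) (r := x.2) |>.1 h
      simp only [ih]
      rw [List.take_add_one, h, finalState_append]
      rfl

end Enumeration

/-! ### Reduction to the atomic ABC Graph -/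

section Recording

variable {X : SeqObject.{u, v, w}} {n : ℕ}

/-- In the states that satisfy the invariant `Inv`, `raw` is the record of all `add` operations. -/
structure GraphObject.IsRecording {n : ℕ} {O : Type v} (G : GraphObject n O) (Inv : G.State → Prop)
    (raw : G.State → Triple n O) : Prop where
  start : Inv G.start ∧ raw G.start = Triple.empty
  addA : ∀ i o σ, Inv σ → Inv (G.addA i o σ) ∧
    raw (G.addA i o σ) = (abcGraph n O).addA i o (raw σ)
  addB : ∀ i o b σ, Inv σ → Inv (G.addB i o b σ) ∧
    raw (G.addB i o b σ) = (abcGraph n O).addB i o b (raw σ)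
  addC : ∀ i o M σ, Inv σ → Inv (G.addC i o M σ) ∧
    raw (G.addC i o M σ) = (abcGraph n O).addC i o M (raw σ)
  read : ∀ σ, Inv σ → G.read σ = (raw σ).merge

theorem iUnion_update_union {ι : Type*} {α β : Type*} [DecidableEq ι] (S : ι → α) (g : α → Set β)
    (i : ι) (a : α) (x : Set β) (h : g a = g (S i) ∪ x) :
    ⋃ j, g (Function.update S i a j) = (⋃ j, g (S j)) ∪ x := by
  ext y
  simp only [Set.mem_iUnion, Set.mem_union]
  constructor
  · rintro ⟨j, hj⟩
    by_cases hji : j = i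
    · subst hji
      rw [Function.update_self, h] at hj
      exact hj.imp (fun h => ⟨_, h⟩) id
    · rw [Function.update_of_ne hji] at hj
      exact .inl ⟨j, hj⟩
  · rintro (⟨j, hj⟩ | hy)
    · by_cases hji : j = i
      · subst hji
        exact ⟨j, by rw [Function.update_self, h]; exact .inl hj⟩
      · exact ⟨j, by rwa [Function.update_of_ne hji]⟩
    · exact ⟨i, by rw [Function.update_self, h]; exact .inr hy⟩

theorem iUnion_update_eq {ι : Type*} {α β : Type*} [DecidableEq ι] (S : ι → α) (g : α → Set β)
    (i : ι) (a : α) (h : g a = g (S i)) :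
    ⋃ j, g (Function.update S i a j) = ⋃ j, g (S j) := by
  simpa using iUnion_update_union S g i a ∅ (by simpa using h)

/-- Each `add` writes to the component exactly what it stores locally, so `R = S` persists. Hence
overwriting a component enlarges the union of all components by just the new element. -/
theorem abcFromSnapshot_isRecording (n : ℕ) (O : Type v) :
    (abcFromSnapshot n O).IsRecording (fun σ => σ.R = σ.S)
      fun σ => ⟨⋃ j, (σ.S j).A, ⋃ j, (σ.S j).B, ⋃ j, (σ.S j).C⟩ where
  start := by simp [abcFromSnapshot, Triple.empty]
  addA i o σ h := by
    refine ⟨by simp [abcFromSnapshot, h], ?_⟩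
    simp only [abcFromSnapshot, abcGraph, Triple.mk.injEq]
    exact ⟨iUnion_update_union _ Triple.A _ _ _ (by simp [h]),
      iUnion_update_eq _ Triple.B _ _ rfl, iUnion_update_eq _ Triple.C _ _ rfl⟩
  addB i o b σ h := by
    refine ⟨by simp [abcFromSnapshot, h], ?_⟩
    simp only [abcFromSnapshot, abcGraph, Triple.mk.injEq]
    exact ⟨iUnion_update_eq _ Triple.A _ _ rfl,
      iUnion_update_union _ Triple.B _ _ _ (by simp [h]), iUnion_update_eq _ Triple.C _ _ rfl⟩
  addC i o M σ h := by
    refine ⟨by simp [abcFromSnapshot, h], ?_⟩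
    simp only [abcFromSnapshot, abcGraph, Triple.mk.injEq]
    exact ⟨iUnion_update_eq _ Triple.A _ _ rfl, iUnion_update_eq _ Triple.B _ _ rfl,
      iUnion_update_union _ Triple.C _ _ _ (by simp [h])⟩
  read _ _ := rfl

variable {G : GraphObject n X.Op} {Inv : G.State → Prop} {raw : G.State → Triple n X.Op}

/-- The configuration in which the graph object is replaced by the record of its operations. -/
def Config.record (raw : G.State → Triple n X.Op) (c : Config X G) :
    Config X (abcGraph n X.Op) :=
  ⟨raw c.graph, c.K, c.cons, c.loc⟩

/-- Steps observe the graph only through `read`, and `read` depends only on the record of past `add`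
operations. -/
theorem Step.record (hG : G.IsRecording Inv raw) {i : Fin n} {c c' : Config X G}
    {e : Option (Event X n)} (h : Step i c e c') (hc : Inv c.graph) :
    Step i (c.record raw) e (c'.record raw) ∧ Inv c'.graph := by
  have habc : c.abc = (c.record raw).abc := hG.read _ hc
  cases h with
  | invoke o h₁ h₂ => exact ⟨.invoke (c.record raw) o h₁ h₂, hc⟩
  | announce o h₁ =>
    obtain ⟨h, h'⟩ := hG.addA i o _ hc
    refine ⟨?_, h⟩
    convert Step.announce (c.record raw) o h₁ using 1
    simp [Config.record, Config.goto, h']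
  | read₁ o h₁ =>
    rw [habc]
    exact ⟨.read₁ (c.record raw) o h₁, hc⟩
  | book o b h₁ =>
    obtain ⟨h, h'⟩ := hG.addB i o b _ hc
    refine ⟨?_, h⟩
    convert Step.book (c.record raw) o b h₁ using 1
    simp [Config.record, Config.goto, h']
  | read₂_committed o l r h₁ h₂ h₃ h₄ =>
    rw [habc] at h₂ h₃
    exact ⟨.read₂_committed (c.record raw) o l r h₁ h₂ h₃ h₄, hc⟩
  | read₂_commutes o l r h₁ h₂ h₃ h₄ h₅ =>
    rw [habc] at h₂ h₃ h₄ ⊢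
    exact ⟨.read₂_commutes (c.record raw) o l r h₁ h₂ h₃ h₄ h₅, hc⟩
  | read₂_conflict o l h₁ h₂ h₃ h₄ =>
    rw [habc] at h₂ h₃ h₄
    exact ⟨.read₂_conflict (c.record raw) o l h₁ h₂ h₃ h₄, hc⟩
  | commit o M r h₁ =>
    obtain ⟨h, h'⟩ := hG.addC i o M _ hc
    refine ⟨?_, h⟩
    convert Step.commit (c.record raw) o M r h₁ using 1
    simp [Config.record, Config.goto, h']
  | snapK o h₁ => exact ⟨.snapK (c.record raw) o h₁, hc⟩
  | loopRead₁_committed o k l r h₁ h₂ h₃ h₄ =>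
    rw [habc] at h₂ h₃
    exact ⟨.loopRead₁_committed (c.record raw) o k l r h₁ h₂ h₃ h₄, hc⟩
  | loopRead₁_select o k o' h₁ h₂ h₃ =>
    rw [habc] at h₂ h₃
    exact ⟨.loopRead₁_select (c.record raw) o k o' h₁ h₂ h₃, hc⟩
  | propose_first o k o' h₁ h₂ => exact ⟨.propose_first (c.record raw) o k o' h₁ h₂, hc⟩
  | propose_later o k o' o'' h₁ h₂ => exact ⟨.propose_later (c.record raw) o k o' o'' h₁ h₂, hc⟩
  | loopRead₂_committed o k o' h₁ h₂ =>
    rw [habc] at h₂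
    exact ⟨.loopRead₂_committed (c.record raw) o k o' h₁ h₂, hc⟩
  | loopRead₂_uncommitted o k o' h₁ h₂ =>
    rw [habc] at h₂ ⊢
    exact ⟨.loopRead₂_uncommitted (c.record raw) o k o' h₁ h₂, hc⟩
  | loopCommit o k o' M h₁ =>
    obtain ⟨h, h'⟩ := hG.addC i o' M _ hc
    refine ⟨?_, h⟩
    convert Step.loopCommit (c.record raw) o k o' M h₁ using 1
    simp [Config.record, Config.goto, h']
  | writeK o k h₁ => exact ⟨.writeK (c.record raw) o k h₁, hc⟩
  | respond o r h₁ => exact ⟨.respond (c.record raw) o r h₁, hc⟩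

/-- Every run is simulated by a run with the atomic ABC Graph. -/
theorem exists_run_abcGraph (hG : G.IsRecording Inv raw) (ρ : Run X G) :
    ∃ ρ' : Run X (abcGraph n X.Op), ρ'.history = ρ.history ∧ ρ'.C = ρ.C := by
  have hinv : ∀ t, Inv (ρ.cfg t).graph := by
    intro t
    induction t with
    | zero =>
      rw [ρ.cfg_zero]
      exact hG.start.1
    | succ t ih =>
      obtain ⟨i, h⟩ | ⟨-, h⟩ := ρ.step t
      · exact (h.record hG ih).2
      · rwa [h]
  refine ⟨⟨fun t => (ρ.cfg t).record raw, ρ.history, ?_, fun t => ?_, ρ.unique⟩, rfl, ?_⟩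
  · rw [ρ.cfg_zero]
    simp only [Config.record, Config.start, hG.start.2]
    rfl
  · obtain ⟨i, h⟩ | ⟨h, h'⟩ := ρ.step t
    · exact .inl ⟨i, (h.record hG (hinv t)).1⟩
    · exact .inr ⟨h, by rw [h']⟩
  · funext t
    exact congrArg Triple.C (hG.read _ (hinv t)).symm

end Recording

/-! ### Merging -/

section Merge

variable {n : ℕ} {O : Type v}

/-- Merging changes neither vertices nor edges. The graph can thus be studied on unmerged records,
where each set comes from a single read. -/
theorem Triple.vertices_merge (T : Triple n O) : T.merge.C.vertices = T.C.vertices := by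
  ext o
  constructor
  · rintro ⟨⟨a, N⟩, ⟨⟨M, hM⟩, hN⟩, rfl | ho⟩
    · exact ⟨_, hM, .inl rfl⟩
    · simp only at hN
      rw [hN] at ho
      obtain ⟨M', hM', ho⟩ := ho
      exact ⟨_, hM', .inr ho⟩
  · rintro ⟨⟨a, M⟩, hM, h⟩
    exact ⟨(a, ⋃₀ {M | (a, M) ∈ T.C}), ⟨⟨M, hM⟩, rfl⟩, h.imp id fun h => ⟨M, hM, h⟩⟩

theorem Triple.edge_merge (T : Triple n O) : T.merge.C.Edge = T.C.Edge := by
  ext a b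
  constructor
  · rintro ⟨N, ⟨-, hN⟩, ha⟩
    simp only at hN
    rw [hN] at ha
    obtain ⟨M, hM, ha⟩ := ha
    exact ⟨M, hM, ha⟩
  · rintro ⟨M, hM, ha⟩
    exact ⟨⋃₀ {M | (b, M) ∈ T.C}, ⟨⟨M, hM⟩, rfl⟩, M, hM, ha⟩

theorem Triple.exists_mem_merge_B {T : Triple n O} {o : Operation n O} {b : ℕ}
    (h : (o, b) ∈ T.B) : ∃ b' ≤ b, (o, b') ∈ T.merge.B := by
  classical
  have hex : ∃ b, (o, b) ∈ T.B := ⟨b, h⟩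
  exact ⟨Nat.find hex, Nat.find_min' hex h, Nat.find_spec hex, fun _ h' => Nat.find_min' hex h'⟩

end Merge

/-! ### Effect of a step -/

section Steps

variable {X : SeqObject.{u, v, w}} {n : ℕ}

/-- The record of all operations on the atomic ABC Graph. -/
def Config.raw (c : Config X (abcGraph n X.Op)) : Triple n X.Op := c.graph

/-- The operation that a process is executing. -/
def Local.pending : Local X n → Option (Operation n X.Op)
  | .idle => none
  | .announce o | .read₁ o | .book o _ | .read₂ o | .commit o _ _ | .snapK o | .loopRead₁ o _
  | .propose o _ _ | .loopRead₂ o _ _ | .loopCommit o _ _ _ | .writeK o _ | .respond o _ => some o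

/-- The operation that a process is executing, if the commutativity test is still ahead. -/
def Local.untested : Local X n → Option (Operation n X.Op)
  | .announce o | .read₁ o | .book o _ | .read₂ o => some o
  | _ => none

variable {i : Fin n} {c c' : Config X (abcGraph n X.Op)} {e : Option (Event X n)}

theorem Step.raw_A (h : Step i c e c') : c'.raw.A = c.raw.A ∨
    ∃ o, c.loc i = .announce o ∧ c'.raw.A = c.raw.A ∪ {o} := by
  cases h <;> first | exact .inl rfl | exact .inr ⟨_, by assumption, rfl⟩

theorem Step.raw_B (h : Step i c e c') : c'.raw.B = c.raw.B ∨
    ∃ o b, c.loc i = .book o b ∧ c'.raw.B = c.raw.B ∪ {(o, b)} := by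
  cases h <;> first | exact .inl rfl | exact .inr ⟨_, _, by assumption, rfl⟩

theorem Step.raw_C (h : Step i c e c') : c'.raw.C = c.raw.C ∨
    ∃ o M, ((∃ r, c.loc i = .commit o M r) ∨ ∃ o' k, c.loc i = .loopCommit o' k o M) ∧
      c'.raw.C = c.raw.C ∪ {(o, M)} := by
  cases h <;> first
    | exact .inl rfl
    | exact .inr ⟨_, _, .inl ⟨_, by assumption⟩, rfl⟩
    | exact .inr ⟨_, _, .inr ⟨_, _, by assumption⟩, rfl⟩

theorem Step.cons_eq (h : Step i c e c') : c'.cons = c.cons ∨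
    ∃ o k v, c.loc i = .propose o k v ∧ c.cons k = none ∧
      c'.cons = Function.update c.cons k (some v) := by
  cases h <;> first
    | exact .inl rfl
    | exact .inr ⟨_, _, _, by assumption, by assumption, rfl⟩

theorem Step.K_eq (h : Step i c e c') : c'.K = c.K ∨
    ∃ o k, c.loc i = .writeK o k ∧ c'.K = Function.update c.K i k := by
  cases h <;> first | exact .inl rfl | exact .inr ⟨_, _, by assumption, rfl⟩

theorem Step.loc_of_ne (h : Step i c e c') {j : Fin n} (hj : j ≠ i) : c'.loc j = c.loc j := by
  cases h <;> exact Function.update_of_ne hj _ _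

theorem Step.pending_eq (h : Step i c e c') :
    (e = none ∧ (c'.loc i).pending = (c.loc i).pending) ∨
    (∃ o, e = some (.inv o) ∧ (c'.loc i).pending = some o ∧ o.caller = i) ∨
    ∃ o r, e = some (.res o r) ∧ c.loc i = .respond o r ∧ c'.loc i = .idle := by
  cases h
  case invoke o hc hi => exact .inr (.inl ⟨o, rfl, by simp [Config.goto, Local.pending], hi⟩)
  case respond o r hc => exact .inr (.inr ⟨o, r, rfl, hc, by simp [Config.goto]⟩)
  all_goals
    refine .inl ⟨rfl, ?_⟩
    simp only [Config.goto, Function.update_self]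
    simp only [*, Local.pending]

theorem Step.untested_eq (h : Step i c e c') {o : Operation n X.Op}
    (ho : (c'.loc i).untested = some o) : e = some (.inv o) ∨ (c.loc i).untested = some o := by
  cases h
  case invoke o' hc hi =>
    simp only [Config.goto, Function.update_self, Local.untested, Option.some.injEq] at ho
    exact .inl (by rw [ho])
  all_goals
    simp only [Config.goto, Function.update_self, Local.untested, reduceCtorEq] at ho
    try exact .inr (by simp only [*, Local.untested])

end Steps

/-! ### Invariants of runs with the atomic ABC Graph -/

namespace Run

variable {X : SeqObject.{u, v, w}} {n : ℕ} (ρ : Run X (abcGraph n X.Op))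

/-- The record of all operations on the graph before time `t`. -/
def raw (t : ℕ) : Triple n X.Op := (ρ.cfg t).raw

/-- The committed operations at time `t`. -/
def V (t : ℕ) : Set (Operation n X.Op) := (ρ.raw t).C.vertices

theorem vertices_C (t : ℕ) : (ρ.C t).vertices = ρ.V t := Triple.vertices_merge _

theorem edge_C {t : ℕ} {a b : Operation n X.Op} :
    (ρ.C t).Edge a b ↔ ∃ M, (b, M) ∈ (ρ.raw t).C ∧ a ∈ M :=
  iff_of_eq (congrFun₂ (Triple.edge_merge (ρ.raw t)) a b)

theorem monotone_of_step {α : Type*} [Preorder α] (g : Config X (abcGraph n X.Op) → α)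
    (h : ∀ i c e c', Step i c e c' → g c ≤ g c') : Monotone fun t => g (ρ.cfg t) := by
  refine monotone_nat_of_le_succ fun t => ?_
  obtain ⟨i, hs⟩ | ⟨-, hs⟩ := ρ.step t
  · exact h _ _ _ _ hs
  · rw [hs]

theorem raw_A_mono : Monotone fun t => (ρ.raw t).A := by
  refine ρ.monotone_of_step (fun c => c.raw.A) fun i c e c' h => ?_
  obtain h | ⟨_, _, h⟩ := h.raw_A <;> simp [h]

theorem raw_B_mono : Monotone fun t => (ρ.raw t).B := by
  refine ρ.monotone_of_step (fun c => c.raw.B) fun i c e c' h => ?_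
  obtain h | ⟨_, _, _, h⟩ := h.raw_B <;> simp [h]

theorem raw_C_mono : Monotone fun t => (ρ.raw t).C := by
  refine ρ.monotone_of_step (fun c => c.raw.C) fun i c e c' h => ?_
  obtain h | ⟨_, _, _, h⟩ := h.raw_C <;> simp [h]

theorem V_mono : Monotone ρ.V := by
  rintro s t hst o ⟨x, hx, h⟩
  exact ⟨x, ρ.raw_C_mono hst hx, h⟩

theorem cons_mono {s t k : ℕ} {o : Operation n X.Op} (hst : s ≤ t)
    (h : (ρ.cfg s).cons k = some o) : (ρ.cfg t).cons k = some o := by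
  induction t, hst using Nat.le_induction with
  | base => exact h
  | succ t _ ih =>
    obtain ⟨i, hs⟩ | ⟨-, hs⟩ := ρ.step t
    · obtain hs | ⟨_, k', _, _, hk', hs⟩ := hs.cons_eq
      · rwa [hs]
      · have : k ≠ k' := by
          rintro rfl
          rw [ih] at hk'
          cases hk'
        rwa [hs, Function.update_of_ne this]
    · rwa [hs]

/-- The source of the time comparisons between reads and commits: membership in the growing set `V`
orders the times. -/
theorem lt_of_mem_V {s t : ℕ} {o : Operation n X.Op} (hs : o ∉ ρ.V s) (ht : o ∈ ρ.V t) : s < t :=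
  lt_of_not_ge fun h => hs (ρ.V_mono h ht)

/-! #### Invocations and responses -/

/-- Both parts need one induction: a fresh invocation has no earlier response only because each
earlier response has an invocation before it, and a response is new only because it was pending. -/
theorem pending_spec (t : ℕ) :
    (∀ i o, ((ρ.cfg t).loc i).pending = some o → o.caller = i ∧
      (∃ j < t, ρ.history j = some (.inv o)) ∧ ∀ j < t, ∀ r, ρ.history j ≠ some (.res o r)) ∧
    ∀ j < t, ∀ o r, ρ.history j = some (.res o r) → (∃ k < j, ρ.history k = some (.inv o)) ∧
      ∀ k < j, ∀ r', ρ.history k ≠ some (.res o r') := by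
  induction t with
  | zero =>
    rw [ρ.cfg_zero]
    exact ⟨fun i o h => (by cases h), fun j hj => by omega⟩
  | succ t ih =>
    obtain ⟨ih₁, ih₂⟩ := ih
    have keep : ∀ i o, (∀ r, ρ.history t ≠ some (.res o r)) →
        ((ρ.cfg t).loc i).pending = some o → o.caller = i ∧
        (∃ j < t + 1, ρ.history j = some (.inv o)) ∧
        ∀ j < t + 1, ∀ r, ρ.history j ≠ some (.res o r) := by
      intro i o ho h
      obtain ⟨h₁, ⟨j, hj, h₂⟩, h₃⟩ := ih₁ i o h
      refine ⟨h₁, ⟨j, by omega, h₂⟩, fun j hj => ?_⟩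
      obtain hj | rfl := Nat.lt_succ_iff_lt_or_eq.1 hj
      · exact h₃ j hj
      · exact ho
    have keep' : (∀ o r, ρ.history t ≠ some (.res o r)) → ∀ j < t + 1, ∀ o r,
        ρ.history j = some (.res o r) → (∃ k < j, ρ.history k = some (.inv o)) ∧
        ∀ k < j, ∀ r', ρ.history k ≠ some (.res o r') := by
      intro h j hj o r hr
      obtain hj | rfl := Nat.lt_succ_iff_lt_or_eq.1 hj
      · exact ih₂ j hj o r hr
      · exact absurd hr (h o r)
    obtain ⟨i, hs⟩ | ⟨he, hs⟩ := ρ.step t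
    · have hloc := fun j => hs.loc_of_ne (j := j)
      obtain ⟨he, hp⟩ | ⟨o, he, hp, hcaller⟩ | ⟨o, r, he, hp, hp'⟩ := hs.pending_eq
      · refine ⟨fun j o h => keep j o (by simp [he]) ?_, keep' (by simp [he])⟩
        by_cases hj : j = i
        · subst hj
          rwa [← hp]
        · rwa [← hloc j hj]
      · refine ⟨fun j o' h => ?_, keep' (by simp [he])⟩
        by_cases hj : j = i
        · subst hj
          obtain rfl : o = o' := by simpa [hp] using h
          refine ⟨hcaller, ⟨t, by omega, he⟩, fun j hj r hr => ?_⟩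
          obtain hj | rfl := Nat.lt_succ_iff_lt_or_eq.1 hj
          · obtain ⟨⟨k, hk, hk'⟩, -⟩ := ih₂ j hj o r hr
            have := ρ.unique _ _ _ hk' he
            omega
          · rw [he] at hr
            cases hr
        · exact keep j o' (by simp [he]) (by rwa [← hloc j hj])
      · obtain ⟨hcaller, hinv, hno⟩ := ih₁ i o (by rw [hp]; rfl)
        refine ⟨fun j o' h => ?_, fun j hj o' r' hr => ?_⟩
        · by_cases hj : j = i
          · subst hj
            rw [hp'] at h
            cases h
          · rw [hloc j hj] at h
            refine keep j o' (fun r' hr => ?_) h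
            rw [he] at hr
            cases hr
            exact hj ((ih₁ j o h).1.symm.trans hcaller)
        · obtain hj | rfl := Nat.lt_succ_iff_lt_or_eq.1 hj
          · exact ih₂ j hj o' r' hr
          · rw [he] at hr
            cases hr
            exact ⟨hinv, hno⟩
    · rw [hs]
      exact ⟨fun i o => keep i o (by simp [he]), keep' (by simp [he])⟩

theorem isHistory : ρ.history.IsHistory := by
  have hres : ∀ i j o r r', ρ.history i = some (.res o r) → ρ.history j = some (.res o r') →
      i = j := by
    intro i j o r r' hi hj
    have h₁ := ((ρ.pending_spec (i + 1)).2 i (by omega) o r hi).2 j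
    have h₂ := ((ρ.pending_spec (j + 1)).2 j (by omega) o r' hj).2 i
    by_contra hne
    obtain h | h := Nat.lt_or_gt_of_ne hne
    · exact h₂ h r hi
    · exact h₁ h r' hj
  refine ⟨?_, fun j o r hj => ((ρ.pending_spec (j + 1)).2 j (by omega) o r hj).1, hres⟩
  rintro i j (o | ⟨o, r⟩) hi hj
  · exact ρ.unique i j o hi hj
  · exact hres i j o r r hi hj

/-- The phase before the test can be entered only by invoking `o`, which happens once; so leaving it
is final. -/
theorem untested_ne {i : Fin n} {o : Operation n X.Op} {s t : ℕ} (hst : s ≤ t)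
    (hinv : ∃ j < s, ρ.history j = some (.inv o))
    (hs : ((ρ.cfg s).loc i).untested ≠ some o) : ((ρ.cfg t).loc i).untested ≠ some o := by
  induction t, hst using Nat.le_induction with
  | base => exact hs
  | succ t hst ih =>
    intro h
    obtain ⟨i', hs⟩ | ⟨-, hs⟩ := ρ.step t
    · by_cases hi : i = i'
      · subst hi
        obtain he | h := hs.untested_eq h
        · obtain ⟨j, hj, hj'⟩ := hinv
          have := ρ.unique _ _ _ hj' he
          omega
        · exact ih h
      · rw [hs.loc_of_ne hi] at h
        exact ih h
    · rw [hs] at h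
      exact ih h

/-! #### Certificates of commits -/

/-- At time `t`, the operation `o` passes the commutativity test with respect to `l`. -/
structure FastRead (t : ℕ) (o : Operation n X.Op) (l : List (Operation n X.Op)) : Prop where
  isTopOrder : (ρ.C t).IsTopOrder l
  mem_A : o ∈ (ρ.raw t).A
  booked : ∃ b, (o, b) ∈ (ρ.raw t).B
  not_mem_V : o ∉ ρ.V t
  commutes : CommutesWithConcurrent X (ρ.cfg t).abc l o
  step : ∃ i M r, (ρ.cfg t).loc i = .read₂ o ∧ (ρ.cfg (t + 1)).loc i = .commit o M r

variable {ρ} in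
-- The caller of `o` determines the process, and after the first test that process has left the
-- phase before the test for good.
theorem FastRead.unique {s s' : ℕ} {o : Operation n X.Op} {l l' : List (Operation n X.Op)}
    (h : ρ.FastRead s o l) (h' : ρ.FastRead s' o l') : s = s' := by
  have key : ∀ {s s' l l'}, ρ.FastRead s o l → ρ.FastRead s' o l' → ¬ s < s' := by
    intro s s' l l' h h' hlt
    obtain ⟨i, M, r, h₁, h₂⟩ := h.step
    obtain ⟨i', _, _, h₁', -⟩ := h'.step
    obtain ⟨hi, ⟨j, hj, hinv⟩, -⟩ := (ρ.pending_spec s).1 i o (by rw [h₁]; rfl)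
    obtain ⟨hi', -⟩ := (ρ.pending_spec s').1 i' o (by rw [h₁']; rfl)
    obtain rfl : i = i' := hi.symm.trans hi'
    refine ρ.untested_ne (s := s + 1) hlt ⟨j, by omega, hinv⟩ ?_ (by rw [h₁']; rfl)
    rw [h₂]
    exact fun h => by cases h
  exact le_antisymm (not_lt.1 (key h' h)) (not_lt.1 (key h h'))

/-- The operations decided in all iterations before `k` are committed at time `t`. -/
def Started (t k : ℕ) : Prop :=
  ∀ k', 1 ≤ k' → k' < k → ∃ o ∈ ρ.V t, (ρ.cfg t).cons k' = some o

/-- At time `t`, the operation `o` is selected for iteration `k`. -/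
def Selected (t k : ℕ) (o : Operation n X.Op) : Prop :=
  ρ.Started t k ∧ IsArgMin (ρ.cfg t).abc o

/-- At time `t`, the operation `o` is found to be the uncommitted decision of iteration `k`. -/
def SlowRead (t k : ℕ) (o : Operation n X.Op) : Prop :=
  1 ≤ k ∧ ρ.Started t k ∧ (ρ.cfg t).cons k = some o ∧ o ∉ ρ.V t

variable {ρ}

theorem Started.mono {s t k : ℕ} (h : ρ.Started s k) (hst : s ≤ t) : ρ.Started t k :=
  fun k' h₁ h₂ => (h k' h₁ h₂).imp fun _ ⟨h₁, h₂⟩ => ⟨ρ.V_mono hst h₁, ρ.cons_mono hst h₂⟩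

theorem Started.succ {t k : ℕ} {o : Operation n X.Op} (h : ρ.Started t k) (ho : o ∈ ρ.V t)
    (hk : (ρ.cfg t).cons k = some o) : ρ.Started t (k + 1) := by
  intro k' h₁ h₂
  obtain h₂ | rfl := Nat.lt_succ_iff_lt_or_eq.1 h₂
  · exact h k' h₁ h₂
  · exact ⟨o, ho, hk⟩

variable (ρ)

/-- `r` is the result of `o` at a commit or in a topological ordering. -/
def Answer (t : ℕ) (o : Operation n X.Op) (r : X.Out) : Prop :=
  (∃ s l, (ρ.C s).IsTopOrder l ∧ X.Result l o r) ∨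
    ∃ s l, ρ.FastRead s o l ∧ (o, ρ.V s) ∈ (ρ.raw t).C ∧ X.Result (l ++ [o]) o r

/-- What a process knows in each of its local states. -/
def LocInv (t : ℕ) : Local X n → Prop
  | .idle | .announce _ | .snapK _ => True
  | .read₁ o => o ∈ (ρ.raw t).A
  | .book o b => ∃ s < t, b = (ρ.raw s).A.ncard ∧ o ∈ (ρ.raw s).A
  | .read₂ o => o ∈ (ρ.raw t).A ∧ ∃ b, (o, b) ∈ (ρ.raw t).B
  | .commit o M r => ∃ s < t, ∃ l, ρ.FastRead s o l ∧ M = ρ.V s ∧ X.Result (l ++ [o]) o r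
  | .loopRead₁ _ k => 1 ≤ k ∧ ρ.Started t k
  | .propose _ k o => 1 ≤ k ∧ ∃ s < t, ρ.Selected s k o
  | .loopRead₂ _ k o => 1 ≤ k ∧ ρ.Started t k ∧ (ρ.cfg t).cons k = some o
  | .loopCommit _ k o M => ∃ s < t, ρ.SlowRead s k o ∧ M = ρ.V s
  | .writeK _ k => ρ.Started t (k + 1)
  | .respond o r => o ∈ ρ.V t ∧ ρ.Answer t o r

theorem LocInv.mono {s t : ℕ} (hst : s ≤ t) {a : Local X n} (h : ρ.LocInv s a) :
    ρ.LocInv t a := by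
  cases a with
  | idle => trivial
  | announce => trivial
  | snapK => trivial
  | read₁ => exact ρ.raw_A_mono hst h
  | book => exact h.imp fun _ h => ⟨h.1.trans_le hst, h.2⟩
  | read₂ => exact ⟨ρ.raw_A_mono hst h.1, h.2.imp fun _ h => ρ.raw_B_mono hst h⟩
  | commit => exact h.imp fun _ h => ⟨h.1.trans_le hst, h.2⟩
  | loopRead₁ => exact ⟨h.1, h.2.mono hst⟩
  | propose => exact ⟨h.1, h.2.imp fun _ h => ⟨h.1.trans_le hst, h.2⟩⟩
  | loopRead₂ => exact ⟨h.1, h.2.1.mono hst, ρ.cons_mono hst h.2.2⟩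
  | loopCommit => exact h.imp fun _ h => ⟨h.1.trans_le hst, h.2⟩
  | writeK => exact Started.mono h hst
  | respond =>
    refine ⟨ρ.V_mono hst h.1, h.2.imp id ?_⟩
    rintro ⟨s', l, h₁, h₂, h₃⟩
    exact ⟨s', l, h₁, ρ.raw_C_mono hst h₂, h₃⟩

/-- The invariant of runs. -/
structure Inv (t : ℕ) : Prop where
  finite_A : (ρ.raw t).A.Finite
  inv_of_mem_A : ∀ o ∈ (ρ.raw t).A, ∃ j < t, ρ.history j = some (.inv o)
  book : ∀ o b, (o, b) ∈ (ρ.raw t).B → ∃ s < t, b = (ρ.raw s).A.ncard ∧ o ∈ (ρ.raw s).A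
  commit : ∀ o M, (o, M) ∈ (ρ.raw t).C → ∃ s < t, M = ρ.V s ∧
    ((∃ l, ρ.FastRead s o l) ∨ ∃ k, ρ.SlowRead s k o)
  cons : ∀ k o, (ρ.cfg t).cons k = some o → ∃ s < t, ρ.Selected s k o
  K : ∀ j, ρ.Started t ((ρ.cfg t).K j + 1)
  loc : ∀ i, ρ.LocInv t ((ρ.cfg t).loc i)

theorem started_one (t : ℕ) : ρ.Started t 1 := fun k' h₁ h₂ => by omega

theorem mem_V_of_mem {t : ℕ} {o : Operation n X.Op} {M : Set (Operation n X.Op)}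
    (h : (o, M) ∈ (ρ.raw t).C) : o ∈ ρ.V t := ⟨_, h, .inl rfl⟩

theorem locInv_step {t : ℕ} (hI : ρ.Inv t) {i : Fin n}
    (h : Step i (ρ.cfg t) (ρ.history t) (ρ.cfg (t + 1))) :
    ρ.LocInv (t + 1) ((ρ.cfg (t + 1)).loc i) := by
  have hi := hI.loc i
  have hle : t ≤ t + 1 := Nat.le_succ t
  have hlt : t < t + 1 := Nat.lt_succ_self t
  have habc : (ρ.cfg t).abc.C.vertices = ρ.V t := ρ.vertices_C t
  generalize hc : ρ.cfg (t + 1) = c' at h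
  generalize ρ.history t = e at h
  cases h with
  | invoke o h₁ h₂ => simp [Config.goto, LocInv]
  | announce o h₁ =>
    simp only [Config.goto, Function.update_self]
    rw [LocInv, raw, hc]
    exact .inr rfl
  | read₁ o h₁ =>
    simp only [Config.goto, Function.update_self]
    rw [h₁] at hi
    exact ⟨t, hlt, rfl, hi⟩
  | book o b h₁ =>
    simp only [Config.goto, Function.update_self]
    rw [h₁] at hi
    obtain ⟨s, hs, -, ho⟩ := hi
    refine ⟨ρ.raw_A_mono (hs.le.trans hle) ho, b, ?_⟩
    rw [raw, hc]
    exact .inr rfl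
  | read₂_committed o l r h₁ h₂ h₃ h₄ =>
    simp only [Config.goto, Function.update_self]
    rw [habc] at h₃
    exact ⟨ρ.V_mono hle h₃, .inl ⟨t, l, h₂, h₄⟩⟩
  | read₂_commutes o l r h₁ h₂ h₃ h₄ h₅ =>
    simp only [Config.goto, Function.update_self]
    rw [habc] at h₃ ⊢
    rw [h₁] at hi
    exact ⟨t, hlt, l, ⟨h₂, hi.1, hi.2, h₃, h₄, i, _, _, h₁, by
      rw [hc]; exact Function.update_self ..⟩, rfl, h₅⟩
  | read₂_conflict o l h₁ h₂ h₃ h₄ => simp [Config.goto, LocInv]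
  | commit o M r h₁ =>
    simp only [Config.goto, Function.update_self]
    rw [h₁] at hi
    obtain ⟨s, hs, l, h₂, rfl, h₃⟩ := hi
    have hmem : (o, ρ.V s) ∈ (ρ.raw (t + 1)).C := by
      rw [raw, hc]
      exact .inr rfl
    exact ⟨ρ.mem_V_of_mem hmem, .inr ⟨s, l, h₂, hmem, h₃⟩⟩
  | snapK o h₁ =>
    simp only [Config.goto, Function.update_self]
    refine ⟨by omega, Started.mono ?_ hle⟩
    -- The maximum of `K` is attained at a component, whose value k certifies that iterations 1, …,
    -- k have committed decisions; k + 1 may start.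
    obtain ⟨j, -, hj⟩ := Finset.exists_mem_eq_sup Finset.univ ⟨i, Finset.mem_univ i⟩ (ρ.cfg t).K
    rw [hj]
    exact hI.K j
  | loopRead₁_committed o k l r h₁ h₂ h₃ h₄ =>
    simp only [Config.goto, Function.update_self]
    rw [habc] at h₂
    exact ⟨ρ.V_mono hle h₂, .inl ⟨t, l, h₃, h₄⟩⟩
  | loopRead₁_select o k o' h₁ h₂ h₃ =>
    simp only [Config.goto, Function.update_self]
    rw [h₁] at hi
    exact ⟨hi.1, t, hlt, hi.2, h₃⟩
  | propose_first o k o' h₁ h₂ =>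
    simp only [Config.goto, Function.update_self]
    rw [h₁] at hi
    obtain ⟨hk, s, hs, h, -⟩ := hi
    refine ⟨hk, h.mono (hs.le.trans hle), ?_⟩
    rw [hc]
    simp [Config.goto]
  | propose_later o k o' o'' h₁ h₂ =>
    simp only [Config.goto, Function.update_self]
    rw [h₁] at hi
    obtain ⟨hk, s, hs, h, -⟩ := hi
    exact ⟨hk, h.mono (hs.le.trans hle), ρ.cons_mono hle h₂⟩
  | loopRead₂_committed o k o' h₁ h₂ =>
    simp only [Config.goto, Function.update_self]
    rw [habc] at h₂
    rw [h₁] at hi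
    exact Started.mono (hi.2.1.succ h₂ hi.2.2) hle
  | loopRead₂_uncommitted o k o' h₁ h₂ =>
    simp only [Config.goto, Function.update_self]
    rw [habc] at h₂ ⊢
    rw [h₁] at hi
    exact ⟨t, hlt, ⟨hi.1, hi.2.1, hi.2.2, h₂⟩, rfl⟩
  | loopCommit o k o' M h₁ =>
    simp only [Config.goto, Function.update_self]
    rw [h₁] at hi
    obtain ⟨s, hs, ⟨-, h₂, h₃, -⟩, rfl⟩ := hi
    have hmem : (o', ρ.V s) ∈ (ρ.raw (t + 1)).C := by
      rw [raw, hc]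
      exact .inr rfl
    exact (h₂.mono (hs.le.trans hle)).succ (ρ.mem_V_of_mem hmem)
      (ρ.cons_mono (hs.le.trans hle) h₃)
  | writeK o k h₁ =>
    simp only [Config.goto, Function.update_self]
    rw [h₁] at hi
    exact ⟨by omega, Started.mono hi hle⟩
  | respond o r h₁ => simp [Config.goto, LocInv]

theorem inv (t : ℕ) : ρ.Inv t := by
  induction t with
  | zero =>
    have hraw : ρ.raw 0 = Triple.empty := by rw [raw, ρ.cfg_zero]; rfl
    refine ⟨?_, ?_, ?_, ?_, ?_, fun j => ?_, fun i => ?_⟩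
    · simp [hraw, Triple.empty]
    · simp [hraw, Triple.empty]
    · simp [hraw, Triple.empty]
    · simp [hraw, Triple.empty]
    · simp [ρ.cfg_zero, Config.start]
    · rw [ρ.cfg_zero]
      -- Initially `K j = 0`, and iterations are numbered from 1, so the certificate is vacuous.
      exact ρ.started_one 0
    · rw [ρ.cfg_zero]
      trivial
  | succ t ih =>
    have hle : t ≤ t + 1 := Nat.le_succ t
    obtain ⟨i, hs⟩ | ⟨-, hs⟩ := ρ.step t
    · have hi := ih.loc i
      refine ⟨?_, ?_, ?_, ?_, ?_, fun j => ?_, fun j => ?_⟩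
      · obtain h | ⟨o, -, h⟩ := hs.raw_A <;> rw [raw, h]
        · exact ih.finite_A
        · exact ih.finite_A.union (Set.finite_singleton o)
      · intro o ho
        have hold : o ∈ (ρ.raw t).A → ∃ j < t + 1, ρ.history j = some (.inv o) := fun h =>
          (ih.inv_of_mem_A o h).imp fun _ h => ⟨h.1.trans_le hle, h.2⟩
        obtain h | ⟨o', ho', h⟩ := hs.raw_A <;> rw [raw, h] at ho
        · exact hold ho
        · obtain ho | rfl := ho
          · exact hold ho
          · obtain ⟨-, ⟨j, hj, h⟩, -⟩ := (ρ.pending_spec t).1 i o (by rw [ho']; rfl)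
            exact ⟨j, hj.trans_le hle, h⟩
      · intro o b hb
        have hold : (o, b) ∈ (ρ.raw t).B →
            ∃ s < t + 1, b = (ρ.raw s).A.ncard ∧ o ∈ (ρ.raw s).A := fun h =>
          (ih.book o b h).imp fun _ h => ⟨h.1.trans_le hle, h.2⟩
        obtain h | ⟨o', b', hb', h⟩ := hs.raw_B <;> rw [raw, h] at hb
        · exact hold hb
        · obtain hb | hb := hb
          · exact hold hb
          · cases hb
            rw [hb'] at hi
            exact hi.imp fun _ h => ⟨h.1.trans_le hle, h.2⟩
      · intro o M hM
        have hold : (o, M) ∈ (ρ.raw t).C → ∃ s < t + 1, M = ρ.V s ∧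
            ((∃ l, ρ.FastRead s o l) ∨ ∃ k, ρ.SlowRead s k o) := fun h =>
          (ih.commit o M h).imp fun _ h => ⟨h.1.trans_le hle, h.2⟩
        obtain h | ⟨o', M', hM', h⟩ := hs.raw_C <;> rw [raw, h] at hM
        · exact hold hM
        · obtain hM | hM := hM
          · exact hold hM
          · cases hM
            obtain ⟨r, h⟩ | ⟨o'', k, h⟩ := hM'
            · rw [h] at hi
              obtain ⟨s, hs, l, h₁, h₂, -⟩ := hi
              exact ⟨s, hs.trans_le hle, h₂, .inl ⟨l, h₁⟩⟩
            · rw [h] at hi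
              obtain ⟨s, hs, h₁, h₂⟩ := hi
              exact ⟨s, hs.trans_le hle, h₂, .inr ⟨k, h₁⟩⟩
      · intro k o hk
        have hold : (ρ.cfg t).cons k = some o → ∃ s < t + 1, ρ.Selected s k o := fun h =>
          (ih.cons k o h).imp fun _ h => ⟨h.1.trans_le hle, h.2⟩
        obtain h | ⟨o', k', v, hv, -, h⟩ := hs.cons_eq <;> rw [h] at hk
        · exact hold hk
        · by_cases hkk : k = k'
          · subst hkk
            obtain rfl : v = o := by simpa using hk
            rw [hv] at hi
            exact hi.2.imp fun _ h => ⟨h.1.trans_le hle, h.2⟩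
          · rw [Function.update_of_ne hkk] at hk
            exact hold hk
      · obtain h | ⟨o, k, hk, h⟩ := hs.K_eq <;> rw [h]
        · exact (ih.K j).mono hle
        · by_cases hj : j = i
          · subst hj
            rw [Function.update_self]
            rw [hk] at hi
            exact Started.mono hi hle
          · rw [Function.update_of_ne hj]
            exact (ih.K j).mono hle
      · by_cases hj : j = i
        · subst hj
          exact ρ.locInv_step ih hs
        · rw [hs.loc_of_ne hj]
          exact LocInv.mono ρ hle (ih.loc j)
    · have hraw : ρ.raw (t + 1) = ρ.raw t := congrArg Config.raw hs
      refine ⟨?_, ?_, ?_, ?_, ?_, fun j => ?_, fun j => ?_⟩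
      · rw [hraw]
        exact ih.finite_A
      · rw [hraw]
        exact fun o h => (ih.inv_of_mem_A o h).imp fun _ h => ⟨h.1.trans_le hle, h.2⟩
      · rw [hraw]
        exact fun o b h => (ih.book o b h).imp fun _ h => ⟨h.1.trans_le hle, h.2⟩
      · rw [hraw]
        exact fun o M h => (ih.commit o M h).imp fun _ h => ⟨h.1.trans_le hle, h.2⟩
      · rw [hs]
        exact fun k o h => (ih.cons k o h).imp fun _ h => ⟨h.1.trans_le hle, h.2⟩
      · rw [hs]
        exact (ih.K j).mono hle
      · rw [hs]
        exact LocInv.mono ρ hle (ih.loc j)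

variable {ρ}

/-! #### The structure of the dependency graph -/

/-- Minimality is read off merged values; every raw booking dominates a merged one, so it holds
against raw bookings too. -/
theorem Selected.mem {t k : ℕ} {o : Operation n X.Op} (h : ρ.Selected t k o) :
    ∃ b, (o, b) ∈ (ρ.raw t).B ∧
      ∀ a b', (a, b') ∈ (ρ.raw t).B → a ∉ ρ.V t → b ≤ b' := by
  obtain ⟨-, b, hb, -, hmin⟩ := h
  refine ⟨b, hb.1, fun a b' hb' ha => ?_⟩
  obtain ⟨b'', hle, h''⟩ := Triple.exists_mem_merge_B hb'
  exact (hmin a b'' h'' (by rwa [← vertices_C] at ha)).trans hle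

theorem SlowRead.exists_selected {t k : ℕ} {o : Operation n X.Op} (h : ρ.SlowRead t k o) :
    ∃ s < t, ρ.Selected s k o :=
  (ρ.inv t).cons k o h.2.2.1

theorem SlowRead.mem_A {t k : ℕ} {o : Operation n X.Op} (h : ρ.SlowRead t k o) :
    o ∈ (ρ.raw t).A := by
  obtain ⟨s, hs, h⟩ := h.exists_selected
  obtain ⟨b, hb, -⟩ := h.mem
  obtain ⟨s', hs', -, ho⟩ := (ρ.inv s).book o b hb
  exact ρ.raw_A_mono (hs'.trans hs).le ho

variable (ρ) in
/-- The operation `x` is committed before time `t` after passing the test at time `s`. -/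
def FastCommit (t s : ℕ) (x : Operation n X.Op) (l : List (Operation n X.Op)) : Prop :=
  (x, ρ.V s) ∈ (ρ.raw t).C ∧ ρ.FastRead s x l

/-- All structural properties of the graph rest on this: a committed set is the whole vertex set at
one earlier moment, at which the operation was announced and not yet a vertex. -/
theorem exists_of_mem_C {t : ℕ} {o : Operation n X.Op} {M : Set (Operation n X.Op)}
    (h : (o, M) ∈ (ρ.raw t).C) : ∃ s < t, M = ρ.V s ∧ o ∉ ρ.V s ∧ o ∈ (ρ.raw s).A ∧
      ((∃ l, ρ.FastCommit t s o l) ∨ ∃ k, ρ.SlowRead s k o) := by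
  obtain ⟨s, hs, rfl, ⟨l, hl⟩ | ⟨k, hk⟩⟩ := (ρ.inv t).commit o M h
  · exact ⟨s, hs, rfl, hl.not_mem_V, hl.mem_A, .inl ⟨l, h, hl⟩⟩
  · exact ⟨s, hs, rfl, hk.2.2.2, hk.mem_A, .inr ⟨k, hk⟩⟩

/-- A vertex that occurs only inside some set `V s` was a vertex at the earlier time s; descending
in time leads to a record of its own. -/
theorem exists_mem_C_of_mem_V {t : ℕ} {o : Operation n X.Op} (h : o ∈ ρ.V t) :
    ∃ M, (o, M) ∈ (ρ.raw t).C := by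
  induction t using Nat.strong_induction_on with
  | _ t ih =>
    obtain ⟨⟨a, M⟩, hM, rfl | ho⟩ := h
    · exact ⟨M, hM⟩
    · obtain ⟨s, hs, rfl, -⟩ := exists_of_mem_C hM
      exact (ih s hs ho).imp fun _ h => ρ.raw_C_mono hs.le h

theorem edge_of_mem {t s : ℕ} {a b : Operation n X.Op} (h : (b, ρ.V s) ∈ (ρ.raw t).C)
    (ha : a ∈ ρ.V s) : (ρ.C t).Edge a b :=
  ρ.edge_C.2 ⟨_, h, ha⟩

theorem exists_of_edge {t : ℕ} {a b : Operation n X.Op} (h : (ρ.C t).Edge a b) :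
    ∃ s < t, (b, ρ.V s) ∈ (ρ.raw t).C ∧ a ∈ ρ.V s ∧ b ∉ ρ.V s := by
  obtain ⟨M, hM, ha⟩ := ρ.edge_C.1 h
  obtain ⟨s, hs, rfl, hb, -⟩ := exists_of_mem_C hM
  exact ⟨s, hs, hM, ha, hb⟩

theorem edge_mono {s t : ℕ} (hst : s ≤ t) {a b : Operation n X.Op} (h : (ρ.C s).Edge a b) :
    (ρ.C t).Edge a b := by
  obtain ⟨M, hM, ha⟩ := ρ.edge_C.1 h
  exact ρ.edge_C.2 ⟨M, ρ.raw_C_mono hst hM, ha⟩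

/-- The record behind the edge was read at a time s with b not in `V s`, so s precedes u and a was
already a vertex. The times t and u are unrelated: edges added after u are covered. -/
theorem mem_V_of_edge {t u : ℕ} {a b : Operation n X.Op} (h : (ρ.C t).Edge a b)
    (hb : b ∈ ρ.V u) : a ∈ ρ.V u := by
  obtain ⟨s, -, -, ha, hb'⟩ := exists_of_edge h
  exact ρ.V_mono (ρ.lt_of_mem_V hb' hb).le ha

theorem not_edge_self (t : ℕ) (a : Operation n X.Op) : ¬ (ρ.C t).Edge a a := by
  intro h
  obtain ⟨s, -, -, ha, ha'⟩ := exists_of_edge h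
  exact ha' ha

theorem edge_trans {t : ℕ} {a b c : Operation n X.Op} (h : (ρ.C t).Edge a b)
    (h' : (ρ.C t).Edge b c) : (ρ.C t).Edge a c := by
  obtain ⟨s, -, hc, hb, -⟩ := exists_of_edge h'
  exact edge_of_mem hc (mem_V_of_edge h hb)

theorem acyclic (t : ℕ) : (ρ.C t).Acyclic := by
  intro o h
  have : ∀ a b, Relation.TransGen (ρ.C t).Edge a b → (ρ.C t).Edge a b := by
    intro a b h
    induction h with
    | single h => exact h
    | tail _ h ih => exact edge_trans ih h
  exact not_edge_self t o (this o o h)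

/-- Iteration k' begins only when the decision of iteration k is committed, and consensus makes that
decision x. -/
theorem SlowRead.mem_V_of_lt {s s' k k' : ℕ} {x y : Operation n X.Op} (hx : ρ.SlowRead s k x)
    (hy : ρ.SlowRead s' k' y) (hk : k < k') : x ∈ ρ.V s' := by
  obtain ⟨o, ho, hcons⟩ := hy.2.1 k hx.1 hk
  have h₁ := ρ.cons_mono (le_max_left s s') hx.2.2.1
  have h₂ := ρ.cons_mono (le_max_right s s') hcons
  rw [h₁] at h₂
  cases h₂
  exact ho

/-- Operations that are not committed on the conflict-free path are totally ordered. -/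
theorem edge_total_of_slow {t : ℕ} {x y : Operation n X.Op} (hx : x ∈ ρ.V t) (hy : y ∈ ρ.V t)
    (hx' : ∀ s l, ¬ ρ.FastCommit t s x l) (hy' : ∀ s l, ¬ ρ.FastCommit t s y l) (hne : x ≠ y) :
    (ρ.C t).Edge x y ∨ (ρ.C t).Edge y x := by
  obtain ⟨M, hM⟩ := exists_mem_C_of_mem_V hx
  obtain ⟨M', hM'⟩ := exists_mem_C_of_mem_V hy
  obtain ⟨s, -, rfl, -, -, ⟨l, h⟩ | ⟨k, hk⟩⟩ := exists_of_mem_C hM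
  · exact absurd h (hx' s l)
  obtain ⟨s', -, rfl, -, -, ⟨l, h⟩ | ⟨k', hk'⟩⟩ := exists_of_mem_C hM'
  · exact absurd h (hy' s' l)
  obtain h | rfl | h := lt_trichotomy k k'
  · exact .inl (edge_of_mem hM' (hk.mem_V_of_lt hk' h))
  · have h₁ := ρ.cons_mono (le_max_left s s') hk.2.2.1
    have h₂ := ρ.cons_mono (le_max_right s s') hk'.2.2.1
    rw [h₁] at h₂
    cases h₂
    exact absurd rfl hne
  · exact .inr (edge_of_mem hM (hk'.mem_V_of_lt hk h))

/-- An operation that is committed through conflict resolution and was not announced at the time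
of the test of `a` has a larger `B`-value than `a`, and is therefore ordered after `a`. -/
theorem edge_of_not_mem_A {t s : ℕ} {a y : Operation n X.Op} {l : List (Operation n X.Op)}
    (ha : ρ.FastCommit t s a l) (hy : y ∈ ρ.V t) (hy' : ∀ s l, ¬ ρ.FastCommit t s y l)
    (hyA : y ∉ (ρ.raw s).A) : (ρ.C t).Edge a y := by
  obtain ⟨M, hM⟩ := exists_mem_C_of_mem_V hy
  obtain ⟨s', -, rfl, -, -, ⟨l, h⟩ | ⟨k, hk⟩⟩ := exists_of_mem_C hM
  · exact absurd h (hy' s' l)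
  obtain ⟨p, hp, hsel⟩ := hk.exists_selected
  obtain ⟨b, hb, hmin⟩ := hsel.mem
  obtain ⟨p', hp', rfl, hyp⟩ := (ρ.inv p).book y b hb
  obtain ⟨b', hb'⟩ := ha.2.booked
  -- The operation y is announced at p' but not at s, so its booked count is taken after the test of
  -- a, while a booked a count taken before that test.
  have hs : s < p' := lt_of_not_ge fun h => hyA (ρ.raw_A_mono h hyp)
  refine edge_of_mem hM (ρ.V_mono hp.le ?_)
  by_contra haV
  have hle := hmin a b' (ρ.raw_B_mono (hs.trans hp').le hb') haV
  obtain ⟨q, hq, rfl, -⟩ := (ρ.inv s).book a b' hb'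
  -- The count of y includes y and that of a does not, so the booked values differ strictly.
  -- Finiteness is essential, as `ncard` of an infinite set is 0.
  refine absurd hle (not_le_of_gt (Set.ncard_lt_ncard ?_ (ρ.inv p').finite_A))
  exact ⟨ρ.raw_A_mono (hq.trans hs).le, fun h => hyA (ρ.raw_A_mono hq.le (h hyp))⟩

/-! #### Linear extensions -/

variable (ρ) in
/-- A linear extension of the dependency graph restricted to a set of operations that contains
the operations preceding each test. -/
structure LinExt (t : ℕ) (s : List (Operation n X.Op)) : Prop where
  nodup : s.Nodup
  pairwise : s.Pairwise fun a b => ¬ (ρ.C t).Edge b a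
  mem_V : ∀ x ∈ s, x ∈ ρ.V t
  closed : ∀ x ∈ s, ∀ u l, ρ.FastCommit t u x l → ∀ y ∈ ρ.V u, y ∈ s

theorem isTopOrder_iff {t : ℕ} {s : List (Operation n X.Op)} : (ρ.C t).IsTopOrder s ↔
    IsOrdering s (ρ.V t) ∧ s.Pairwise fun a b => ¬ (ρ.C t).Edge b a := by
  rw [← vertices_C]
  exact ⟨fun h => ⟨h.1, (isTopOrder_iff_pairwise h.1 (not_edge_self t)).1 h⟩,
    fun h => (isTopOrder_iff_pairwise h.1 (not_edge_self t)).2 h.2⟩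

theorem linExt_of_isTopOrder {t : ℕ} {s : List (Operation n X.Op)} (h : (ρ.C t).IsTopOrder s) :
    ρ.LinExt t s := by
  obtain ⟨⟨h₁, h₂⟩, h₃⟩ := isTopOrder_iff.1 h
  refine ⟨h₁, h₃, fun x hx => (h₂ x).1 hx, fun x hx u l hu y hy => (h₂ y).2 ?_⟩
  exact mem_V_of_edge (edge_of_mem hu.1 hy) ((h₂ x).1 hx)

/-- What the test of x saw committed has an edge to x, so it stands before x and survives
truncation. -/
theorem LinExt.of_append {t : ℕ} {p q : List (Operation n X.Op)} (h : ρ.LinExt t (p ++ q)) :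
    ρ.LinExt t p := by
  obtain ⟨h₁, h₂, h₃, h₄⟩ := h
  obtain ⟨hp, -, hpq⟩ := List.pairwise_append.1 h₂
  refine ⟨(List.nodup_append.1 h₁).1, hp, fun x hx => h₃ x (List.mem_append_left _ hx),
    fun x hx u l hu y hy => ?_⟩
  exact (List.mem_append.1 (h₄ x (List.mem_append_left _ hx) u l hu y hy)).resolve_right
    fun hyq => hpq x hx y hyq (edge_of_mem hu.1 hy)

theorem LinExt.perm {t : ℕ} {s s' : List (Operation n X.Op)} (h : ρ.LinExt t s)
    (hp : s.Perm s') (h' : s'.Pairwise fun a b => ¬ (ρ.C t).Edge b a) : ρ.LinExt t s' :=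
  ⟨hp.nodup h.nodup, h', fun x hx => h.mem_V x (hp.mem_iff.2 hx),
    fun x hx u l hu y hy => hp.mem_iff.1 (h.closed x (hp.mem_iff.2 hx) u l hu y hy)⟩

/-- An operation that was tested against all others can be moved to the end. -/
theorem LinExt.move_to_end {t s : ℕ} {x : Operation n X.Op} {l p q : List (Operation n X.Op)}
    (h : ρ.LinExt t (p ++ x :: q)) (hx : ρ.FastCommit t s x l)
    (hA : ∀ y ∈ p ++ x :: q, y ∈ (ρ.raw s).A)
    (ihs : ∀ l', (ρ.C s).IsTopOrder l' → SeqEqv X l' l)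
    (ihp : ∀ p', ρ.LinExt t p' → p.Perm p' → SeqEqv X p p') :
    SeqEqv X (p ++ x :: q) (p ++ q ++ [x]) ∧
      ∀ r, X.Result (l ++ [x]) x r → X.Result (p ++ x :: q) x r := by
  classical
  have hst : s < t := ρ.lt_of_mem_V hx.2.not_mem_V (ρ.mem_V_of_mem hx.1)
  obtain ⟨hn₁, hn₂, hn₃⟩ := List.nodup_append.1 h.nodup
  obtain ⟨hxq, hn₂⟩ := List.nodup_cons.1 hn₂
  obtain ⟨hpw₁, hpw₂, hpw₃⟩ := List.pairwise_append.1 h.pairwise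
  have hpw₄ := (List.pairwise_cons.1 hpw₂).1
  -- All of `V s` consists of predecessors of x, so it lies entirely in front of x.
  have hDp : ∀ y ∈ ρ.V s, y ∈ p := by
    intro y hy
    have hedge := edge_of_mem hx.1 hy
    have := h.closed x (by simp) s l hx y hy
    simp only [List.mem_append, List.mem_cons] at this
    obtain h | rfl | h := this
    · exact h
    · exact absurd hy hx.2.not_mem_V
    · exact absurd hedge (hpw₄ y h)
  -- Being closed under predecessors, `V s` can be moved to the front of p, an equivalence by `ihp`.
  -- The front block is then a topological ordering of the graph at time s, so `ihs` replaces it by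
  -- l.
  set l' := p.filter fun y => decide (y ∈ ρ.V s) with hl'
  set p' := p.filter fun y => !decide (y ∈ ρ.V s) with hp'
  have hperm : p.Perm (l' ++ p') := (List.filter_append_perm _ p).symm
  have hpl : SeqEqv X p (l' ++ p') := by
    refine ihp _ (h.of_append.perm hperm (List.pairwise_append.2 ⟨hpw₁.sublist
      List.filter_sublist, hpw₁.sublist List.filter_sublist, fun d hd e he hed => ?_⟩)) hperm
    simp only [hl', hp', List.mem_filter, decide_eq_true_eq, Bool.not_eq_true',
      decide_eq_false_iff_not] at hd he
    exact he.2 (mem_V_of_edge hed hd.2)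
  have hl'top : (ρ.C s).IsTopOrder l' := by
    refine isTopOrder_iff.2 ⟨⟨hn₁.filter _, fun y => ?_⟩, (hpw₁.sublist List.filter_sublist).imp
      fun hn he => hn (edge_mono hst.le he)⟩
    simp only [hl', List.mem_filter, decide_eq_true_eq]
    exact ⟨fun h => h.2, fun h => ⟨hDp y h, h⟩⟩
  have hpl : SeqEqv X p (l ++ p') := hpl.trans ((ihs l' hl'top).append_right p')
  have hnp' : p'.Nodup := hn₁.filter _
  have hmem_p' : ∀ y ∈ p', y ∈ p ∧ y ∉ ρ.V s := by
    intro y hy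
    simpa [hp'] using hy
  have hxp : x ∉ p := fun hxp => hn₃ x hxp x (by simp) rfl
  have hqV : ∀ y ∈ q, y ∉ ρ.V s := fun y hy hyV =>
    hn₃ y (hDp y hyV) y (List.mem_cons_of_mem _ hy) rfl
  have hcomm : ∀ z : List (Operation n X.Op), z.Nodup →
      (∀ y ∈ z, y ∈ p ++ x :: q ∧ y ∉ ρ.V s ∧ y ≠ x) →
      SeqEqv X (l ++ z ++ [x]) (l ++ [x] ++ z) := by
    intro z hz hz'
    refine (hx.2.commutes {y | y ∈ z} (fun y hy => ?_) z ⟨hz, fun _ => .rfl⟩).seqEqv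
    obtain ⟨h₁, h₂, h₃⟩ := hz' y hy
    refine ⟨⟨hA y h₁, ?_⟩, h₃⟩
    change y ∉ (ρ.C s).vertices
    rwa [vertices_C]
  -- The test is used twice: against p' to bring x directly behind l, where its response is that of
  -- the test, and against `p' ++ q` to send x to the end.
  have h₁ := hcomm p' hnp' fun y hy => ⟨List.mem_append_left _ (hmem_p' y hy).1,
    (hmem_p' y hy).2, fun h => hxp (h ▸ (hmem_p' y hy).1)⟩
  have h₂ := hcomm (p' ++ q) (List.nodup_append.2 ⟨hnp', hn₂, fun a ha b hb =>
      hn₃ a (hmem_p' a ha).1 b (List.mem_cons_of_mem _ hb)⟩) fun y hy => by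
    obtain hy | hy := List.mem_append.1 hy
    · exact ⟨List.mem_append_left _ (hmem_p' y hy).1,
        (hmem_p' y hy).2, fun h => hxp (h ▸ (hmem_p' y hy).1)⟩
    · exact ⟨by simp [hy], hqV y hy, fun h => hxq (h ▸ hy)⟩
  have hleft : SeqEqv X (p ++ x :: q) (l ++ [x] ++ (p' ++ q)) := by
    have h₃ := (hpl.append_right ([x] ++ q)).trans (by simpa using h₁.append_right q)
    simpa using h₃
  refine ⟨hleft.trans (h₂.symm.trans ?_), fun r hr => ?_⟩
  · simpa using (hpl.append_right (q ++ [x])).symm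
  · exact (hleft.2.2 x r).2 (result_append.2 (.inl hr))

/-- All linear extensions are equivalent, and every operation committed on the conflict-free path
has the response that was determined with the test. -/
theorem linExt_spec (t : ℕ)
    (iht : ∀ s < t, ∀ l l', (ρ.C s).IsTopOrder l → (ρ.C s).IsTopOrder l' → SeqEqv X l l') (m : ℕ) :
    ∀ s, s.length = m → ρ.LinExt t s →
      (∀ s', ρ.LinExt t s' → s.Perm s' → SeqEqv X s s') ∧
      ∀ x ∈ s, ∀ u l r, ρ.FastCommit t u x l → X.Result (l ++ [x]) x r → X.Result s x r := by
  classical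
  induction m using Nat.strong_induction_on with
  | _ m ih =>
  intro s hm hs
  -- The dichotomy: some slow operation lies after all fast ones, or each slow one fails to follow
  -- some fast one.
  by_cases hlast : ∃ y ∈ s, (∀ u l, ¬ ρ.FastCommit t u y l) ∧
      ∀ a ∈ s, ∀ u l, ρ.FastCommit t u a l → (ρ.C t).Edge a y
  · obtain ⟨y, hy, hyslow, hyafter⟩ := hlast
    obtain ⟨p, z, rfl⟩ : ∃ p z, s = p ++ [z] :=
      ⟨_, _, (List.dropLast_append_getLast (List.ne_nil_of_mem hy)).symm⟩
    have hpz := (List.pairwise_append.1 hs.pairwise).2.2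
    -- If z were fast it would precede y, yet nothing comes after z.
    have hzslow : ∀ u l, ¬ ρ.FastCommit t u z l := by
      intro u l hz
      have hzy := hyafter z (by simp) u l hz
      obtain hy | hy := List.mem_append.1 hy
      · exact hpz y hy z (by simp) hzy
      · obtain rfl := List.mem_singleton.1 hy
        exact hyslow u l hz
    have hslow : ∀ a ∈ p, (∀ u l, ¬ ρ.FastCommit t u a l) → (ρ.C t).Edge a z := by
      intro a ha haslow
      have hne : a ≠ z := (List.nodup_append.1 hs.nodup).2.2 a ha z (by simp)
      exact (edge_total_of_slow (hs.mem_V a (by simp [ha])) (hs.mem_V z (by simp)) haslow hzslow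
        hne).resolve_right (hpz a ha z (by simp))
    have hmax : ∀ a ∈ p, (ρ.C t).Edge a z := by
      intro a ha
      by_cases hfast : ∀ u l, ¬ ρ.FastCommit t u a l
      · exact hslow a ha hfast
      · push Not at hfast
        obtain ⟨u, l, hu⟩ := hfast
        have hay := hyafter a (by simp [ha]) u l hu
        obtain hy | hy := List.mem_append.1 hy
        · exact edge_trans hay (hslow y hy hyslow)
        · obtain rfl := List.mem_singleton.1 hy
          exact hay
    obtain ⟨ih₁, ih₂⟩ := ih p.length (by simp [← hm]) p rfl hs.of_append
    refine ⟨fun s' hs' hperm => ?_, fun x hx u l r hu hr => ?_⟩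
    · obtain ⟨p', z', rfl⟩ : ∃ p' z', s' = p' ++ [z'] :=
        ⟨_, _, (List.dropLast_append_getLast (List.ne_nil_of_mem (hperm.mem_iff.1 hy))).symm⟩
      -- All other elements precede z, so every linear extension of the same set ends with z.
      obtain rfl : z' = z := by
        by_contra hne
        have h₁ : z' ∈ p := by
          have : z' ∈ p ++ [z] := hperm.mem_iff.2 (by simp)
          simpa [hne] using this
        have h₂ : z ∈ p' := by
          have : z ∈ p' ++ [z'] := hperm.mem_iff.1 (by simp)
          simpa [Ne.symm hne] using this
        exact (List.pairwise_append.1 hs'.pairwise).2.2 z h₂ z' (by simp) (hmax z' h₁)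
      exact (ih₁ p' hs'.of_append ((List.perm_append_right_iff _).1 hperm)).append_right _
    · obtain hx | hx := List.mem_append.1 hx
      · exact result_append.2 (.inl (ih₂ x hx u l r hu hr))
      · obtain rfl := List.mem_singleton.1 hx
        exact absurd hu (hzslow u l)
  · push Not at hlast
    obtain rfl | ⟨y₀, hy₀⟩ : s = [] ∨ ∃ y, y ∈ s :=
      s.eq_nil_or_concat.imp id fun ⟨_, y, h⟩ => ⟨y, by simp [h]⟩
    · refine ⟨fun s' _ hperm => ?_, fun x hx => by cases hx⟩
      rw [hperm.nil_eq]
      exact .refl _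
    have hex : ∃ u, ∃ x ∈ s, ∃ l, ρ.FastCommit t u x l := by
      by_cases h : ∀ u l, ¬ ρ.FastCommit t u y₀ l
      · obtain ⟨a, ha, u, l, hu, -⟩ := hlast y₀ hy₀ h
        exact ⟨u, a, ha, l, hu⟩
      · push Not at h
        obtain ⟨u, l, hu⟩ := h
        exact ⟨u, y₀, hy₀, l, hu⟩
    have hbound : ∀ u x l, ρ.FastCommit t u x l → u < t := fun u x l h =>
      ρ.lt_of_mem_V h.2.not_mem_V (ρ.mem_V_of_mem h.1)
    -- Choose x with the latest test among the fast operations present; test times are bounded by t.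
    obtain ⟨u, ⟨x, hx, l, hu⟩, hmax⟩ : ∃ u, (∃ x ∈ s, ∃ l, ρ.FastCommit t u x l) ∧
        ∀ u', (∃ x ∈ s, ∃ l, ρ.FastCommit t u' x l) → u' ≤ u := by
      obtain ⟨u₀, hu₀⟩ := hex
      have hle : ∀ u', (∃ x ∈ s, ∃ l, ρ.FastCommit t u' x l) → u' ≤ t :=
        fun u' ⟨x, _, l, h⟩ => (hbound u' x l h).le
      exact ⟨_, Nat.findGreatest_spec (P := fun u => ∃ x ∈ s, ∃ l, ρ.FastCommit t u x l)
        (hle u₀ hu₀) hu₀, fun u' hu' => Nat.le_findGreatest (hle u' hu') hu'⟩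
    -- A fast operation is announced by its own test. A slow one unannounced at u would be
    -- unannounced at every test, and would follow all fast ones.
    have hA : ∀ y ∈ s, y ∈ (ρ.raw u).A := by
      intro y hy
      by_cases h : ∀ u l, ¬ ρ.FastCommit t u y l
      · by_contra hyA
        obtain ⟨a, ha, u', l', hu', hn⟩ := hlast y hy h
        exact hn (edge_of_not_mem_A hu' (hs.mem_V y hy) h
          fun hyA' => hyA (ρ.raw_A_mono (hmax u' ⟨a, ha, l', hu'⟩) hyA'))
      · push Not at h
        obtain ⟨u', l', hu'⟩ := h
        exact ρ.raw_A_mono (hmax u' ⟨y, hy, l', hu'⟩) hu'.2.mem_A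
    have hut := hbound u x l hu
    have move : ∀ l, ρ.FastCommit t u x l → ∀ s', ρ.LinExt t s' → s.Perm s' → ∃ p, ρ.LinExt t p ∧ s.Perm (p ++ [x]) ∧
        SeqEqv X s' (p ++ [x]) ∧ ∀ r, X.Result (l ++ [x]) x r → X.Result s' x r := by
      intro l hu s' hs' hperm
      obtain ⟨p, q, rfl⟩ := List.append_of_mem (hperm.mem_iff.1 hx)
      have hlen := hperm.length_eq
      simp only [List.length_append, List.length_cons] at hlen
      obtain ⟨h₁, h₂⟩ := hs'.move_to_end hu (fun y hy => hA y (hperm.mem_iff.2 hy))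
        (fun l' hl' => iht u hut l' l hl' hu.2.isTopOrder)
        (ih p.length (by omega) p rfl hs'.of_append).1
      refine ⟨p ++ q, ⟨?_, ?_, ?_, ?_⟩, hperm.trans h₁.1, h₁, h₂⟩
      · exact hs'.nodup.sublist (by simp)
      · exact hs'.pairwise.sublist (by simp)
      · exact fun y hy => hs'.mem_V y (by simp at hy ⊢; tauto)
      · intro y hy u' l' hu' w hw
        have hy' : y ∈ p ++ x :: q := by simp at hy ⊢; tauto
        have hw' := hs'.closed y hy' u' l' hu' w hw
        -- A test that saw x committed would come after the test of x, contradicting the choice of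
        -- u. So removing x keeps the list closed.
        have hwx : w ≠ x := by
          rintro rfl
          exact absurd (hmax u' ⟨y, hperm.mem_iff.2 hy', l', hu'⟩)
            (not_le_of_gt (ρ.lt_of_mem_V hu.2.not_mem_V hw))
        simpa [hwx] using hw'
    obtain ⟨p, hp, hpp, hps, hpr⟩ := move l hu s hs (.refl _)
    have hlen := hpp.length_eq
    simp only [List.length_append, List.length_cons, List.length_nil] at hlen
    obtain ⟨ih₁, ih₂⟩ := ih p.length (by omega) p rfl hp
    refine ⟨fun s' hs' hperm => ?_, fun y hy u' l' r hu' hr => ?_⟩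
    · obtain ⟨p', hp', hpp', hps', -⟩ := move l hu s' hs' hperm
      exact hps.trans (((ih₁ p' hp' ((List.perm_append_right_iff _).1
        (hpp.symm.trans hpp'))).append_right _).trans hps'.symm)
    · obtain hy | hy := List.mem_append.1 (hpp.mem_iff.1 hy)
      · exact (hps.2.2 y r).2 (result_append.2 (.inl (ih₂ y hy u' l' r hu' hr)))
      · obtain rfl := List.mem_singleton.1 hy
        -- Only the test time is determined, not the ordering; this is why `move` is stated for
        -- every l.
        obtain rfl := hu'.2.unique hu.2
        obtain ⟨-, -, -, -, hres⟩ := move l' hu' s hs (.refl _)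
        exact hres r hr

/-! #### Results in topological orderings -/

theorem seqEqv_of_isTopOrder {t : ℕ} {s s' : List (Operation n X.Op)}
    (h : (ρ.C t).IsTopOrder s) (h' : (ρ.C t).IsTopOrder s') : SeqEqv X s s' := by
  induction t using Nat.strong_induction_on generalizing s s' with
  | _ t ih =>
    exact (linExt_spec t (fun u hu _ _ h h' => ih u hu h h') _ s rfl (linExt_of_isTopOrder h)).1 s'
      (linExt_of_isTopOrder h') (h.1.perm h'.1)

theorem result_of_fastCommit {t u : ℕ} {s l : List (Operation n X.Op)} {x : Operation n X.Op}
    {r : X.Out} (h : (ρ.C t).IsTopOrder s) (hx : ρ.FastCommit t u x l)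
    (hr : X.Result (l ++ [x]) x r) : X.Result s x r :=
  (linExt_spec t (fun _ _ _ _ h h' => seqEqv_of_isTopOrder h h') _ s rfl
    (linExt_of_isTopOrder h)).2 x (((isTopOrder_iff.1 h).1.2 x).2 (ρ.mem_V_of_mem hx.1)) u l r hx hr

/-- As `V t₁` is closed under predecessors in the later graph, some ordering of that graph starts
with an ordering of the earlier one, and a prefix fixes the responses of its operations. -/
theorem Result.mono_time {t₁ t₂ : ℕ} {s₁ s₂ : List (Operation n X.Op)} (hle : t₁ ≤ t₂)
    (h₁ : (ρ.C t₁).IsTopOrder s₁) (h₂ : (ρ.C t₂).IsTopOrder s₂) {o : Operation n X.Op} {r : X.Out}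
    (hr : X.Result s₁ o r) : X.Result s₂ o r := by
  classical
  obtain ⟨⟨hn, hmem⟩, hpw⟩ := isTopOrder_iff.1 h₂
  set p := s₂.filter fun y => decide (y ∈ ρ.V t₁) with hp
  set q := s₂.filter fun y => !decide (y ∈ ρ.V t₁) with hq
  have hperm : s₂.Perm (p ++ q) := (List.filter_append_perm _ s₂).symm
  have hpq : (ρ.C t₂).IsTopOrder (p ++ q) := by
    refine isTopOrder_iff.2 ⟨⟨hperm.nodup hn, fun y => hperm.mem_iff.symm.trans (hmem y)⟩,
      List.pairwise_append.2 ⟨hpw.sublist List.filter_sublist, hpw.sublist List.filter_sublist,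
        fun d hd e he hed => ?_⟩⟩
    simp only [hp, hq, List.mem_filter, decide_eq_true_eq, Bool.not_eq_true',
      decide_eq_false_iff_not] at hd he
    exact he.2 (mem_V_of_edge hed hd.2)
  have hptop : (ρ.C t₁).IsTopOrder p := by
    refine isTopOrder_iff.2 ⟨⟨hn.filter _, fun y => ?_⟩,
      (hpw.sublist List.filter_sublist).imp fun hn he => hn (edge_mono hle he)⟩
    simp only [hp, List.mem_filter, decide_eq_true_eq]
    exact ⟨fun h => h.2, fun h => ⟨(hmem y).2 (ρ.V_mono hle h), h⟩⟩
  exact ((seqEqv_of_isTopOrder hpq h₂).2.2 o r).1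
    (result_append.2 (.inl (((seqEqv_of_isTopOrder h₁ hptop).2.2 o r).1 hr)))

theorem result_unique {t₁ t₂ : ℕ} {s₁ s₂ : List (Operation n X.Op)}
    (h₁ : (ρ.C t₁).IsTopOrder s₁) (h₂ : (ρ.C t₂).IsTopOrder s₂) {o : Operation n X.Op}
    {r₁ r₂ : X.Out} (hr₁ : X.Result s₁ o r₁) (hr₂ : X.Result s₂ o r₂) : r₁ = r₂ := by
  obtain h | h := le_total t₁ t₂
  · exact Result.unique h₂.1.1 (Result.mono_time h h₁ h₂ hr₁) hr₂
  · exact Result.unique h₁.1.1 hr₁ (Result.mono_time h h₂ h₁ hr₂)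

/-! #### The order of the first commits -/

variable (ρ) in
open Classical in
/-- The operation that is committed for the first time at time `t`. -/
noncomputable def newCommit (t : ℕ) : Option (Operation n X.Op) :=
  if h : ∃ o, o ∈ ρ.V (t + 1) ∧ o ∉ ρ.V t then some h.choose else none

variable (ρ) in
/-- The operations committed before time `t` in the order of their first commits. -/
noncomputable def commitOrder : ℕ → List (Operation n X.Op)
  | 0 => []
  | t + 1 => commitOrder t ++ (ρ.newCommit t).toList

theorem newCommit_eq_some_iff {t : ℕ} {o : Operation n X.Op} :
    ρ.newCommit t = some o ↔ o ∈ ρ.V (t + 1) ∧ o ∉ ρ.V t := by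
  classical
  -- Each new vertex has a record of its own, and a step adds at most one record.
  have huniq : ∀ o o', o ∈ ρ.V (t + 1) → o ∉ ρ.V t → o' ∈ ρ.V (t + 1) → o' ∉ ρ.V t → o = o' := by
    intro o o' h₁ h₂ h₃ h₄
    obtain ⟨M, hM⟩ := exists_mem_C_of_mem_V h₁
    obtain ⟨M', hM'⟩ := exists_mem_C_of_mem_V h₃
    have hM₂ : (o, M) ∉ (ρ.raw t).C := fun h => h₂ (ρ.mem_V_of_mem h)
    have hM₄ : (o', M') ∉ (ρ.raw t).C := fun h => h₄ (ρ.mem_V_of_mem h)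
    obtain ⟨i, hs⟩ | ⟨-, hs⟩ := ρ.step t
    · obtain h | ⟨a, N, -, h⟩ := hs.raw_C <;> rw [raw, h] at hM hM'
      · exact absurd hM hM₂
      · have h := hM.resolve_left hM₂
        have h' := hM'.resolve_left hM₄
        exact congrArg Prod.fst (h.trans h'.symm)
    · rw [raw, hs] at hM
      exact absurd hM hM₂
  rw [newCommit]
  split_ifs with h
  · obtain ⟨h₁, h₂⟩ := h.choose_spec
    rw [Option.some.injEq]
    constructor
    · rintro rfl
      exact ⟨h₁, h₂⟩
    · exact fun h' => huniq _ _ h₁ h₂ h'.1 h'.2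
  · exact ⟨fun h' => (by cases h'), fun h' => absurd ⟨o, h'⟩ h⟩

theorem exists_newCommit {t : ℕ} {o : Operation n X.Op} (h : o ∈ ρ.V t) :
    ∃ s < t, ρ.newCommit s = some o := by
  induction t with
  | zero =>
    obtain ⟨⟨a, M⟩, hM, -⟩ := h
    obtain ⟨s, hs, -⟩ := exists_of_mem_C hM
    omega
  | succ t ih =>
    by_cases ho : o ∈ ρ.V t
    · exact (ih ho).imp fun _ h => ⟨h.1.trans (Nat.lt_succ_self t), h.2⟩
    · exact ⟨t, Nat.lt_succ_self t, newCommit_eq_some_iff.2 ⟨h, ho⟩⟩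

theorem commitOrder_isOrdering (t : ℕ) : IsOrdering (ρ.commitOrder t) (ρ.V t) := by
  induction t with
  | zero =>
    refine ⟨List.nodup_nil, fun o => ⟨fun h => (by cases h), fun h => ?_⟩⟩
    obtain ⟨s, hs, -⟩ := exists_newCommit h
    omega
  | succ t ih =>
    refine ⟨List.nodup_append.2 ⟨ih.1, ?_, ?_⟩, fun o => ?_⟩
    · cases ρ.newCommit t <;> simp
    · intro a ha b hb
      rw [Option.mem_toList, newCommit_eq_some_iff] at hb
      rintro rfl
      exact hb.2 ((ih.2 a).1 ha)
    · rw [commitOrder, List.mem_append, ih.2, Option.mem_toList,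
        newCommit_eq_some_iff]
      refine ⟨fun h => h.elim (fun h => ρ.V_mono (Nat.le_succ t) h) And.left, fun h => ?_⟩
      by_cases ho : o ∈ ρ.V t
      · exact .inl ho
      · exact .inr ⟨h, ho⟩

theorem commitOrder_prefix {s t : ℕ} (h : s ≤ t) : ρ.commitOrder s <+: ρ.commitOrder t := by
  induction t, h using Nat.le_induction with
  | base => exact List.prefix_rfl
  | succ t _ ih => exact ih.trans (List.prefix_append _ _)

/-- Along an edge from a to b, at the read behind it a was already committed and b was not; so a
lies in a prefix that lacks b. -/
theorem commitOrder_isTopOrder (t : ℕ) : (ρ.C t).IsTopOrder (ρ.commitOrder t) := by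
  have hord := ρ.commitOrder_isOrdering t
  refine ⟨by rwa [vertices_C], fun a b hab => ?_⟩
  obtain ⟨s, hs, hb, ha, hb'⟩ := exists_of_edge hab
  obtain ⟨q, hq⟩ := ρ.commitOrder_prefix hs.le
  have ha := ((ρ.commitOrder_isOrdering s).2 a).2 ha
  have hbt := (hord.2 b).2 (ρ.mem_V_of_mem hb)
  rw [← hq] at hbt ⊢
  have hbq := (List.mem_append.1 hbt).resolve_left
    fun h => hb' (((ρ.commitOrder_isOrdering s).2 b).1 h)
  exact (List.singleton_sublist.2 ha).append (List.singleton_sublist.2 hbq)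

/-! #### Linearizations -/

theorem respond_spec {t : ℕ} {o : Operation n X.Op} {r : X.Out}
    (h : ρ.history t = some (.res o r)) : o ∈ ρ.V t ∧ ρ.Answer t o r := by
  obtain ⟨i, hs⟩ | ⟨he, -⟩ := ρ.step t
  · obtain ⟨he, -⟩ | ⟨o', he, -⟩ | ⟨o', r', he, hp, -⟩ := hs.pending_eq <;> rw [h] at he
    · cases he
    · cases he
    · cases he
      have := (ρ.inv t).loc i
      rw [hp] at this
      exact this
  · rw [h] at he
    cases he

/-- A response computed at a test is compared at time t, when the fast record is already present,
and then carried to t' by invariance of results. -/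
theorem Answer.result {t t' : ℕ} {o : Operation n X.Op} {r : X.Out} {s : List (Operation n X.Op)}
    (h : ρ.Answer t o r) (hs : (ρ.C t').IsTopOrder s) (ho : o ∈ ρ.V t') : X.Result s o r := by
  obtain ⟨r', hr'⟩ := exists_result (X := X) (((isTopOrder_iff.1 hs).1.2 o).2 ho)
  obtain ⟨u, l, hl, hr⟩ | ⟨u, l, hl, hC, hr⟩ := h
  · rwa [result_unique hl hs hr hr']
  · have := result_of_fastCommit (ρ.commitOrder_isTopOrder t) ⟨hC, hl⟩ hr
    rwa [result_unique (ρ.commitOrder_isTopOrder t) hs this hr']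

theorem exists_inv_of_mem_V {t : ℕ} {o : Operation n X.Op} (h : o ∈ ρ.V t) :
    ρ.history.Occurs (.inv o) := by
  obtain ⟨M, hM⟩ := exists_mem_C_of_mem_V h
  obtain ⟨s, -, -, -, hA, -⟩ := exists_of_mem_C hM
  obtain ⟨j, -, hj⟩ := (ρ.inv s).inv_of_mem_A o hA
  exact ⟨j, hj⟩

/-- Any record of o' comes from a read after its announcement, hence after the response of o, when o
was already committed. -/
theorem edge_of_precedes {o o' : Operation n X.Op} (h : ρ.history.Precedes o o') {t : ℕ}
    (ho' : o' ∈ ρ.V t) : (ρ.C t).Edge o o' := by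
  obtain ⟨i, j, r, hij, hi, hj⟩ := h
  obtain ⟨M, hM⟩ := exists_mem_C_of_mem_V ho'
  obtain ⟨s, -, rfl, -, hA, -⟩ := exists_of_mem_C hM
  obtain ⟨j', hj', hinv⟩ := (ρ.inv s).inv_of_mem_A o' hA
  have := ρ.unique _ _ _ hj hinv
  exact edge_of_mem hM (ρ.V_mono (by omega) (respond_spec hi).1)

/-- No final graph is needed: the commit orders are prefixes of one another and jointly give an
enumeration, indexed by the times of first commits. -/
theorem linearizable : ρ.history.Linearizable := by
  set f : ℕ → Option (Operation n X.Op × X.Out) := fun t => (ρ.newCommit t).map fun o =>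
    (o, (X.spec o.op (X.finalState X.start (ρ.commitOrder t))).1) with hf
  have hfsome : ∀ {t o r}, f t = some (o, r) ↔ ρ.newCommit t = some o ∧
      r = (X.spec o.op (X.finalState X.start (ρ.commitOrder t))).1 := by
    intro t o r
    simp only [hf]
    cases ρ.newCommit t with
    | none => simp
    | some a =>
      simp only [Option.map_some, Option.some.injEq, Prod.mk.injEq]
      constructor
      · rintro ⟨rfl, rfl⟩
        exact ⟨rfl, rfl⟩
      · rintro ⟨rfl, rfl⟩
        exact ⟨rfl, rfl⟩
  have hstate : ∀ t, enumState f t = X.finalState X.start (ρ.commitOrder t) := by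
    intro t
    induction t with
    | zero => rfl
    | succ t ih =>
      rw [enumState, commitOrder, finalState_append, ← ih]
      simp only [hf]
      cases ρ.newCommit t <;> rfl
  refine ⟨enumHistory f, isLinearization_enumHistory ?_ ?_ ?_ ?_ ?_⟩
  · intro i j o r r' hi hj
    have hi := newCommit_eq_some_iff.1 (hfsome.1 hi).1
    have hj := newCommit_eq_some_iff.1 (hfsome.1 hj).1
    have h₁ := ρ.lt_of_mem_V hi.2 hj.1
    have h₂ := ρ.lt_of_mem_V hj.2 hi.1
    omega
  · intro i o r hi
    exact exists_inv_of_mem_V (newCommit_eq_some_iff.1 (hfsome.1 hi).1).1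
  · rintro o r ⟨t, ht⟩
    obtain ⟨ho, hans⟩ := respond_spec ht
    obtain ⟨s, -, hs⟩ := exists_newCommit ho
    refine ⟨s, hfsome.2 ⟨hs, ?_⟩⟩
    -- At time s + 1 the operation o has just become the last element, so its response is computed
    -- from the state after `commitOrder s`.
    have htop := ρ.commitOrder_isTopOrder (s + 1)
    refine Result.unique htop.1.1 (hans.result htop (newCommit_eq_some_iff.1 hs).1) ?_
    rw [commitOrder, hs]
    exact result_append.2 (.inr (by simp [SeqObject.responses]))
  · intro o o' h i j r r' hi hj
    have hi := newCommit_eq_some_iff.1 (hfsome.1 hi).1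
    have hj := newCommit_eq_some_iff.1 (hfsome.1 hj).1
    obtain ⟨s, hs, -, ho, -⟩ := exists_of_edge (edge_of_precedes h hj.1)
    have := ρ.lt_of_mem_V hi.2 ho
    omega
  · intro j o r hj
    rw [hstate]
    exact (hfsome.1 hj).2

theorem isLinearization_seqHistory {N : ℕ} (hN : ∀ t, N ≤ t → ρ.C t = ρ.C N)
    {s : List (Operation n X.Op)} (hs : (ρ.C N).IsTopOrder s) :
    ρ.history.IsLinearization (seqHistory X s) := by
  have hV : ∀ t, ρ.V t ⊆ ρ.V N := by
    intro t
    obtain h | h := le_total t N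
    · exact ρ.V_mono h
    · rw [← vertices_C, hN t h, vertices_C]
  obtain ⟨⟨hnodup, hmem⟩, hpw⟩ := isTopOrder_iff.1 hs
  rw [seqHistory_eq_enumHistory]
  refine isLinearization_enumHistory ?_ ?_ ?_ ?_ ?_
  · intro i j o r r' hi hj
    have hi := (responses_getElem?_eq.1 hi).1
    have hj := (responses_getElem?_eq.1 hj).1
    exact (List.getElem?_inj (List.getElem?_eq_some_iff.1 hi).1 hnodup).1 (hi.trans hj.symm)
  · intro i o r hi
    have hi := (responses_getElem?_eq.1 hi).1
    exact exists_inv_of_mem_V ((hmem o).1 (List.mem_of_getElem? hi))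
  · rintro o r ⟨t, ht⟩
    obtain ⟨ho, hans⟩ := respond_spec ht
    exact List.getElem?_of_mem (hans.result hs (hV t ho))
  · intro o o' h i j r r' hi hj
    obtain ⟨hi', hi⟩ := List.getElem?_eq_some_iff.1 (responses_getElem?_eq.1 hi).1
    obtain ⟨hj', hj⟩ := List.getElem?_eq_some_iff.1 (responses_getElem?_eq.1 hj).1
    have hedge := edge_of_precedes h ((hmem o').1 (hj ▸ List.getElem_mem hj'))
    by_contra hlt
    obtain hlt | rfl := Nat.lt_or_eq_of_le (not_lt.1 hlt)
    · have := List.pairwise_iff_getElem.1 hpw j i hj' hi' hlt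
      rw [hi, hj] at this
      exact this hedge
    · rw [← hi, ← hj] at hedge
      exact not_edge_self N _ hedge
  · intro j o r hj
    rw [enumState_responses]
    exact (responses_getElem?_eq.1 hj).2

end Run

end DynConc

/-! ### The theorem for both forms of the graph object. -/

theorem mainTheorem1 (X : DynConc.SeqObject.{u, v, w}) (n : ℕ)
    (G : DynConc.GraphObject n X.Op)
    (hG : G = DynConc.abcGraph n X.Op ∨ G = DynConc.abcFromSnapshot n X.Op)
    (ρ : DynConc.Run X G) :
    -- the induced history is linearizable
    ρ.history.IsHistory ∧ ρ.history.Linearizable ∧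
    -- every topological ordering of the final graph is a linearization of the induced history
    (∀ N, (∀ t, N ≤ t → ρ.C t = ρ.C N) →
      (∃ s, (ρ.C N).IsTopOrder s) ∧
      ∀ s, (ρ.C N).IsTopOrder s → ρ.history.IsLinearization (DynConc.seqHistory X s)) ∧
    -- `C` is acyclic and transitive at all times
    (∀ t, (ρ.C t).Acyclic ∧ ∀ a b c, (ρ.C t).Edge a b → (ρ.C t).Edge b c → (ρ.C t).Edge a c) ∧
    -- operations are committed on return
    (∀ t o r, ρ.history t = some (.res o r) → o ∈ (ρ.C t).vertices) ∧
    -- real-time order is respected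
    (∀ o o', ρ.history.Precedes o o' → ∀ t, o' ∈ (ρ.C t).vertices →
      ∀ s, (ρ.C t).IsTopOrder s → List.Sublist [o, o'] s) ∧
    -- all topological orderings of `C` are equivalent
    (∀ t s s', (ρ.C t).IsTopOrder s → (ρ.C t).IsTopOrder s' → DynConc.EquivSeq X s s') ∧
    -- responses do not change over time
    (∀ t₁ t₂ s₁ s₂, (ρ.C t₁).IsTopOrder s₁ → (ρ.C t₂).IsTopOrder s₂ →
      ∀ o r₁ r₂, X.Result s₁ o r₁ → X.Result s₂ o r₂ → r₁ = r₂) ∧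
    -- returned responses agree with the sequential specification
    (∀ t₂ o r, o ∈ (ρ.C t₂).vertices → ρ.history.Occurs (.res o r) →
      ∃ t₁ ≤ t₂, ∃ s, (ρ.C t₁).IsTopOrder s ∧ X.Result s o r) := by
  obtain ⟨ρ', hH, hC⟩ : ∃ ρ' : DynConc.Run X (DynConc.abcGraph n X.Op),
      ρ'.history = ρ.history ∧ ρ'.C = ρ.C := by
    rcases hG with rfl | rfl
    · exact ⟨ρ, rfl, rfl⟩
    · exact DynConc.exists_run_abcGraph (DynConc.abcFromSnapshot_isRecording n X.Op) ρ
  rw [← hH, ← hC]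
  refine ⟨ρ'.isHistory, DynConc.Run.linearizable,
    fun N hN => ⟨⟨_, ρ'.commitOrder_isTopOrder N⟩,
      fun s hs => DynConc.Run.isLinearization_seqHistory hN hs⟩,
    fun t => ⟨DynConc.Run.acyclic t, fun a b c => DynConc.Run.edge_trans⟩, fun t o r h => ?_,
    fun o o' h t ho' s hs => ?_, fun t s s' hs hs' => ?_,
    fun t₁ t₂ s₁ s₂ h₁ h₂ o r₁ r₂ => DynConc.Run.result_unique h₁ h₂, ?_⟩
  · rw [DynConc.Run.vertices_C]
    exact (DynConc.Run.respond_spec h).1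
  · rw [DynConc.Run.vertices_C] at ho'
    exact hs.2 _ _ (DynConc.Run.edge_of_precedes h ho')
  · exact (DynConc.Run.seqEqv_of_isTopOrder hs hs').equivSeq hs.1.1
  · rintro t o r ho ⟨t', ht'⟩
    rw [DynConc.Run.vertices_C] at ho
    have htop := ρ'.commitOrder_isTopOrder t
    -- The bound `t₁ ≤ t₂` is met with equality: by invariance of results, any ordering that
    -- contains the operation shows its response.
    exact ⟨t, le_rfl, _, htop, (DynConc.Run.respond_spec ht').2.result htop ho⟩
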